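/- Let $E\to\mathbb R^n$ be a smooth real vector bundle of finite rank with a smooth fibre metric, let $\alpha<\beta$ in $[-\infty,\infty]$, let $I=\{t\in\mathbb R:\alpha\le t<\beta\}$, and let $\nabla_t$, $t\in I$, be a solution of the Yang–Mills flow on $E$, i.e. a family of metric-compatible connections, smooth in $(x,t)\in\mathbb R^n\times I$, with $$\frac{\partial\nabla_t}{\partial t}=-D^*_{\nabla_t}F_{\nabla_t},\qquad (D^*_\nabla F_\nabla)_j=-\sum_i\nabla_iF_{ij},\qquad F_{ij}=[\nabla_i,\nabla_j].$$ Put $|F_\nabla|^2=\sum_{i,j}|F_{ij}|^2=-\sum_{i,j}\operatorname{tr}(F_{ij}F_{ij})$. For $x_0\in\mathbb R^n$ and $t_0\in\mathbb R$ define, with values in $[0,\infty]$, $$\mathcal F_{x_0,t_0}(\nabla,t)=(t-t_0)^2\int_{\mathbb R^n}|F_\nabla|^2\,\frac{e^{-|x-x_0|^2/4(t_0-t)}}{(4\pi(t_0-t))^{n/2}}\,dx\qquad(t<t_0),$$ $$\mathcal F^{\mathcal T}_{x_0,t_0}(\nabla,t)=\int_{\mathbb R^n}|F_\nabla|^2\,e^{\langle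 x_0,x\rangle-|x_0|^2(t-t_0)}\,dx\qquad(t\in\mathbb R),$$ $$\mathcal F^{\mathcal E}_{x_0,t_0}(\nabla,t)=(t_0-t)^2\int_{\mathbb R^n}|F_\nabla|^2\,\frac{e^{|x-x_0|^2/4(t-t_0)}}{(4\pi(t-t_0))^{n/2}}\,dx\qquad(t>t_0).$$ Let $\Phi(t)$ be any one of $\mathcal F_{x_0,t_0}(\nabla_t,t)$, $\mathcal F^{\mathcal T}_{x_0,t_0}(\nabla_t,t)$, $\mathcal F^{\mathcal E}_{x_0,t_0}(\nabla_t,t)$, considered on $J=I\cap(-\infty,t_0)$, $J=I$, $J=I\cap(t_0,\infty)$ respectively. If $\int_a^b\Phi(t)\,dt<\infty$ for all $a\le b$ in $J$, then $\Phi$ is monotonically non-increasing on $J$. -/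

import Mathlib

open Set MeasureTheory Bundle
open scoped Manifold ContDiff

noncomputable section

namespace YangMills

/-- Euclidean space `ℝⁿ`, the base manifold. -/
abbrev Rn (n : ℕ) : Type := EuclideanSpace ℝ (Fin n)

section Connection

variable {n : ℕ} {F : Type*} [NormedAddCommGroup F] [NormedSpace ℝ F]
  {V : Rn n → Type*} [TopologicalSpace (TotalSpace F V)]
  [∀ x, NormedAddCommGroup (V x)] [∀ x, InnerProductSpace ℝ (V x)]
  [FiberBundle F V]

/-- `∇_j σ`, the covariant derivative of the section `σ` along the coordinate field `∂_j`. -/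
def nabla (D : CovariantDerivative 𝓘(ℝ, Rn n) F V) (j : Fin n) (σ : Π x, V x) : Π x, V x :=
  fun x => D σ x (EuclideanSpace.single j (1 : ℝ) : Rn n)

/-- `F_{ij} σ = ∇_i ∇_j σ - ∇_j ∇_i σ`: the curvature, as an operator on sections
(the coordinate fields commute, so there is no bracket term). -/
def curvatureOp (D : CovariantDerivative 𝓘(ℝ, Rn n) F V) (i j : Fin n) (σ : Π x, V x) :
    Π x, V x :=
  nabla D i (nabla D j σ) - nabla D j (nabla D i σ)

/-- The curvature endomorphism `F_{ij}(x)` of the fibre `V x`, evaluated at `v`. For a smooth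
connection, `(F_{ij} σ)(x)` depends only on `σ x`; here `σ` is the extension of `v` to a section
that is constant in the preferred trivialization around `x`. -/
def curvature (D : CovariantDerivative 𝓘(ℝ, Rn n) F V) (x : Rn n) (i j : Fin n) (v : V x) : V x :=
  curvatureOp D i j (FiberBundle.extend F v) x

/-- The `j`-th component of `D^* F`, as an operator on sections:
`(D^* F)_j = - ∑_i ∇_i F_{ij}`, where `(∇_i F_{ij}) σ = ∇_i (F_{ij} σ) - F_{ij} (∇_i σ)`. -/
def divCurvatureOp (D : CovariantDerivative 𝓘(ℝ, Rn n) F V) (j : Fin n) (σ : Π x, V x) :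
    Π x, V x :=
  -∑ i, (nabla D i (curvatureOp D i j σ) - curvatureOp D i j (nabla D i σ))

variable [FiniteDimensional ℝ F] [VectorBundle ℝ F V]

/-- The squared norm `|F|²(x) = ∑_{i,j} |F_{ij}(x)|²` of the curvature at `x`, where
`|A|² = ∑_a |A e_a|²` for an orthonormal basis `(e_a)` of the fibre `V x`. -/
def curvatureNormSq (D : CovariantDerivative 𝓘(ℝ, Rn n) F V) (x : Rn n) : ℝ :=
  haveI : FiniteDimensional ℝ (V x) := VectorBundle.finiteDimensional ℝ F V x
  ∑ i, ∑ j, ∑ a, ‖curvature D x i j (stdOrthonormalBasis ℝ (V x) a)‖ ^ 2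

/-- The family of connections `∇_t`, `t ∈ I`, is smooth in `(t, x)` jointly: for each section `σ`
that is smooth on an open set `U` and each `j`, the section `(t, x) ↦ (∇_t)_j σ (x)` is smooth
on `I × U` (one-sidedly in `t` at an endpoint of `I` that belongs to `I`). -/
def IsSmoothFamily (I : Set ℝ) (D : ℝ → CovariantDerivative 𝓘(ℝ, Rn n) F V) : Prop :=
  ∀ (U : Set (Rn n)) (σ : Π x, V x), IsOpen U →
    ContMDiffOn 𝓘(ℝ, Rn n) (𝓘(ℝ, Rn n).prod 𝓘(ℝ, F)) ∞
      (fun x => TotalSpace.mk' F x (σ x)) U →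
    ∀ j : Fin n, ContMDiffOn 𝓘(ℝ, ℝ × Rn n) (𝓘(ℝ, Rn n).prod 𝓘(ℝ, F)) ∞
      (fun p : ℝ × Rn n => TotalSpace.mk' F p.2 (nabla (D p.1) j σ p.2)) (I ×ˢ U)

/-- `∇_t`, `t ∈ I`, is a (smooth) solution of the Yang-Mills flow `∂_t ∇_t = - D^* F_{∇_t}`
through connections compatible with the fibre metric. The time derivative of `∇_t` is the
`End(V)`-valued one-form that is tested on sections `σ` smooth near the point `x`. -/
structure IsYangMillsFlow [ContMDiffVectorBundle ∞ F V 𝓘(ℝ, Rn n)]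
    [IsContMDiffRiemannianBundle 𝓘(ℝ, Rn n) ∞ F V]
    (I : Set ℝ) (D : ℝ → CovariantDerivative 𝓘(ℝ, Rn n) F V) : Prop where
  metric : ∀ t ∈ I, (D t).IsMetricCompatible
  smooth : IsSmoothFamily I D
  evolution : ∀ t ∈ I, ∀ (x : Rn n) (σ : Π x, V x),
    ContMDiffAt 𝓘(ℝ, Rn n) (𝓘(ℝ, Rn n).prod 𝓘(ℝ, F)) ∞ (fun x => TotalSpace.mk' F x (σ x)) x →
    ∀ j : Fin n, HasDerivWithinAt (fun s => nabla (D s) j σ x) (-divCurvatureOp (D t) j σ x) I t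

end Connection

section Kernels

variable {n : ℕ}

/-- The shrinker kernel based at `(x₀, t₀)`, for `t < t₀`. -/
def shrinkerKernel (x₀ : Rn n) (t₀ : ℝ) (x : Rn n) (t : ℝ) : ℝ :=
  Real.exp (-‖x - x₀‖ ^ 2 / (4 * (t₀ - t))) / (4 * Real.pi * (t₀ - t)) ^ ((n : ℝ) / 2)

/-- The translator kernel based at `(x₀, t₀)`. -/
def translatorKernel (x₀ : Rn n) (t₀ : ℝ) (x : Rn n) (t : ℝ) : ℝ :=
  Real.exp (inner ℝ x₀ x - ‖x₀‖ ^ 2 * (t - t₀))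

/-- The expander kernel based at `(x₀, t₀)`, for `t > t₀`. -/
def expanderKernel (x₀ : Rn n) (t₀ : ℝ) (x : Rn n) (t : ℝ) : ℝ :=
  Real.exp (‖x - x₀‖ ^ 2 / (4 * (t - t₀))) / (4 * Real.pi * (t - t₀)) ^ ((n : ℝ) / 2)

end Kernels

section Functionals

variable {n : ℕ} {F : Type*} [NormedAddCommGroup F] [NormedSpace ℝ F]
  {V : Rn n → Type*} [TopologicalSpace (TotalSpace F V)]
  [∀ x, NormedAddCommGroup (V x)] [∀ x, InnerProductSpace ℝ (V x)]
  [FiberBundle F V] [FiniteDimensional ℝ F] [VectorBundle ℝ F V]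

/-- `𝓕_{x₀,t₀}(∇, t) = (t - t₀)² ∫ |F_∇|² G_{x₀,t₀}(x,t) dx`, with values in `[0, ∞]`. -/
def shrinkerFunctional (x₀ : Rn n) (t₀ : ℝ) (D : CovariantDerivative 𝓘(ℝ, Rn n) F V) (t : ℝ) :
    ENNReal :=
  ENNReal.ofReal ((t - t₀) ^ 2) *
    ∫⁻ x, ENNReal.ofReal (curvatureNormSq D x * shrinkerKernel x₀ t₀ x t)

/-- `𝓕ᵀ_{x₀,t₀}(∇, t) = ∫ |F_∇|² Gᵀ_{x₀,t₀}(x,t) dx`, with values in `[0, ∞]`. -/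
def translatorFunctional (x₀ : Rn n) (t₀ : ℝ) (D : CovariantDerivative 𝓘(ℝ, Rn n) F V) (t : ℝ) :
    ENNReal :=
  ∫⁻ x, ENNReal.ofReal (curvatureNormSq D x * translatorKernel x₀ t₀ x t)

/-- `𝓕ᴱ_{x₀,t₀}(∇, t) = (t₀ - t)² ∫ |F_∇|² Gᴱ_{x₀,t₀}(x,t) dx`, with values in `[0, ∞]`. -/
def expanderFunctional (x₀ : Rn n) (t₀ : ℝ) (D : CovariantDerivative 𝓘(ℝ, Rn n) F V) (t : ℝ) :
    ENNReal :=
  ENNReal.ofReal ((t₀ - t) ^ 2) *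
    ∫⁻ x, ENNReal.ofReal (curvatureNormSq D x * expanderKernel x₀ t₀ x t)

end Functionals

/-- The real times `t` with `α ≤ t < β`, for extended real `α` and `β`. -/
def timeInterval (α β : EReal) : Set ℝ := {t | α ≤ (t : EReal) ∧ (t : EReal) < β}

/-- `f` has a finite integral over each compact interval `[a, b]` with endpoints in the
interval `J`. -/
def LocallyFiniteIntegralOn (f : ℝ → ENNReal) (J : Set ℝ) : Prop :=
  ∀ a ∈ J, ∀ b ∈ J, ∫⁻ t in Icc a b, f t < ⊤

end YangMills

end

/-! Write `u = |F|²`, `J_j = ∑_i ∇_i F_{ij}`, `T_{ik} = ∑_j ⟨F_{ij}, F_{kj}⟩`, `S_i = ∑_j ⟨F_{ij},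
J_j⟩` and `N = |J|²`. The flow reads `∂_t ∇ = J`, and the Bianchi identity gives two scalar
identities: `div T = ∇u/4 + S` and `∂_t u = 4 div S - 4N`.

All three kernels, with their powers of `t - t₀` absorbed, are positive weights `H` with `∇ log H =
p`, where `p = c(t)(x - x₁) + q` is affine, and with `∂_t H = -ΔH + 4cH`. The vector field `W = 4S +
4Tp - up` has a divergence in which `∇u` cancels, and one finds `∂_t(uH) = div(HW) - 4H |J + p⌟F|²`.
Formally, integrating over space gives monotonicity.

No decay is assumed, so the computation is done against a cutoff `φ²`. Completing the square with
`φJ + (∇φ + φp)⌟F` leaves only the error `(4 T(∇φ,∇φ) + 2φ ⟨∇φ, p⟩ u) H`, bounded by a multiple of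
`uH`. With `|∇φ| = O(1/R)` on the annulus `R ≤ |x - x₁| ≤ 2R` and `p` of linear growth, that
multiple is bounded independently of `R`. The space-time integral of the error is then at most a
constant times the tail of the integrable function `uH`, which tends to zero; Fatou's lemma finishes
the proof.

The scalar identities are proved in a local trivialization, for a matrix-valued connection form and
a tracial functional. Metric compatibility makes curvature skew, so Hilbert–Schmidt products are
minus traces, which are independent of the frame; orthonormal frames are never needed. The main
steps are `divergence_stressForm`, `hasDerivAt_energyForm`, `IsStressFlow.weightedEnergyDeriv_le`,
`abs_cutoffError_le` and `IsStressFlow.lintegral_weightedEnergy_le`. -/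

noncomputable section

set_option linter.unusedSectionVars false

namespace YangMills

/-! ### Connections in a local trivialization: `∇_j = ∂_j + A_j`. -/

section Gauge

variable {n : ℕ} {F : Type*} [NormedAddCommGroup F] [NormedSpace ℝ F] [FiniteDimensional ℝ F]
  {V : Rn n → Type*} [TopologicalSpace (TotalSpace F V)]
  [∀ x, NormedAddCommGroup (V x)] [∀ x, InnerProductSpace ℝ (V x)]
  [FiberBundle F V] [VectorBundle ℝ F V]

/-- A section is smooth on `U`. -/
abbrev SmoothSectionOn (σ : Π x, V x) (U : Set (Rn n)) : Prop :=
  ContMDiffOn 𝓘(ℝ, Rn n) (𝓘(ℝ, Rn n).prod 𝓘(ℝ, F)) ∞ (fun x => TotalSpace.mk' F x (σ x)) U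

/-- The connection sends smooth sections to smooth sections, locally. -/
def SmoothConnection (D : CovariantDerivative 𝓘(ℝ, Rn n) F V) : Prop :=
  ∀ (U : Set (Rn n)) (σ : Π x, V x), IsOpen U → SmoothSectionOn (F := F) σ U →
    ∀ j : Fin n, SmoothSectionOn (F := F) (nabla D j σ) U

/-- The `i`-th coordinate vector of `ℝⁿ`. -/
abbrev coordVec (i : Fin n) : Rn n := EuclideanSpace.single i (1 : ℝ)

variable (e : Trivialization F (TotalSpace.proj : TotalSpace F V → Rn n))
  [MemTrivializationAtlas e]

/-- The local representative of a section in a trivialization. -/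
def localRep (σ : Π x, V x) (y : Rn n) : F := (e ⟨y, σ y⟩).2

/-- The section that is constant in a trivialization. -/
def frameSection (v : F) : Π x, V x := fun y => e.symm y v

/-- The `j`-th component of the connection form of `D` in a trivialization. -/
def connectionForm (D : CovariantDerivative 𝓘(ℝ, Rn n) F V) (j : Fin n) (y : Rn n) : F →L[ℝ] F :=
  ∑ a, (LinearMap.toContinuousLinearMap ((Module.finBasis ℝ F).coord a)).smulRight
    (localRep e (nabla D j (frameSection e (Module.finBasis ℝ F a))) y)

variable {e}

lemma localRep_eq_continuousLinearMapAt {y : Rn n} (hy : y ∈ e.baseSet) (σ : Π x, V x) :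
    localRep e σ y = e.continuousLinearMapAt ℝ y (σ y) :=
  (e.continuousLinearMapAt_apply_of_mem (R := ℝ) hy _).symm

lemma localRep_frameSection {y : Rn n} (hy : y ∈ e.baseSet) (v : F) :
    localRep e (frameSection e v) y = v := by
  rw [localRep, frameSection, e.apply_mk_symm hy]

lemma symmL_localRep {y : Rn n} (hy : y ∈ e.baseSet) (σ : Π x, V x) :
    e.symmL ℝ y (localRep e σ y) = σ y := by
  rw [localRep_eq_continuousLinearMapAt hy, e.symmL_continuousLinearMapAt hy]

lemma localRep_sub {y : Rn n} (hy : y ∈ e.baseSet) (σ τ : Π x, V x) :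
    localRep e (σ - τ) y = localRep e σ y - localRep e τ y := by
  simp [localRep_eq_continuousLinearMapAt hy]

variable [ContMDiffVectorBundle ∞ F V 𝓘(ℝ, Rn n)]

lemma smoothSectionOn_iff {σ : Π x, V x} {U : Set (Rn n)} (hU : IsOpen U) (hUe : U ⊆ e.baseSet) :
    SmoothSectionOn (F := F) σ U ↔ ContDiffOn ℝ ∞ (localRep e σ) U := by
  rw [SmoothSectionOn, e.contMDiffOn_section_iff hU hUe, contMDiffOn_iff_contDiffOn]
  rfl

lemma smoothSectionOn_frameSection (v : F) :
    SmoothSectionOn (F := F) (frameSection e v) e.baseSet := by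
  rw [smoothSectionOn_iff e.open_baseSet subset_rfl]
  exact contDiffOn_const.congr fun y hy => localRep_frameSection hy v

lemma SmoothSectionOn.mdifferentiableAt {σ : Π x, V x} {U : Set (Rn n)}
    (h : SmoothSectionOn (F := F) σ U) (hU : IsOpen U) {y : Rn n} (hy : y ∈ U) :
    MDifferentiableAt 𝓘(ℝ, Rn n) (𝓘(ℝ, Rn n).prod 𝓘(ℝ, F))
      (fun x => TotalSpace.mk' F x (σ x)) y :=
  ((h y hy).contMDiffAt (hU.mem_nhds hy)).mdifferentiableAt (by simp)

lemma nabla_add_apply (D : CovariantDerivative 𝓘(ℝ, Rn n) F V) (j : Fin n) {σ τ : Π x, V x}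
    {y : Rn n}
    (hσ : MDifferentiableAt 𝓘(ℝ, Rn n) (𝓘(ℝ, Rn n).prod 𝓘(ℝ, F))
      (fun x => TotalSpace.mk' F x (σ x)) y)
    (hτ : MDifferentiableAt 𝓘(ℝ, Rn n) (𝓘(ℝ, Rn n).prod 𝓘(ℝ, F))
      (fun x => TotalSpace.mk' F x (τ x)) y) :
    nabla D j (σ + τ) y = nabla D j σ y + nabla D j τ y :=
  congrArg (fun L : Rn n →L[ℝ] V y => L (coordVec j))
    (D.isCovariantDerivativeOnUniv.add hσ hτ)

lemma nabla_smul_apply (D : CovariantDerivative 𝓘(ℝ, Rn n) F V) (j : Fin n) {σ : Π x, V x}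
    {g : Rn n → ℝ} {y : Rn n} {g' : Rn n →L[ℝ] ℝ}
    (hσ : MDifferentiableAt 𝓘(ℝ, Rn n) (𝓘(ℝ, Rn n).prod 𝓘(ℝ, F))
      (fun x => TotalSpace.mk' F x (σ x)) y)
    (hg : HasFDerivAt g g' y) :
    nabla D j (g • σ) y = g y • nabla D j σ y + g' (coordVec j) • σ y := by
  have h := congrArg (fun L : Rn n →L[ℝ] V y => L (coordVec j))
    (D.isCovariantDerivativeOnUniv.leibniz hσ hg.differentiableAt.mdifferentiableAt)
  have h1 : mfderiv 𝓘(ℝ, Rn n) 𝓘(ℝ, ℝ) g y = g' := by rw [mfderiv_eq_fderiv, hg.fderiv]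
  have h2 : mvfderiv 𝓘(ℝ, Rn n) g y = g' := by
    ext v
    simp only [mvfderiv, h1]
    rfl
  rw [h2] at h
  exact h

lemma nabla_congr_apply (D : CovariantDerivative 𝓘(ℝ, Rn n) F V) (j : Fin n) {σ τ : Π x, V x}
    {y : Rn n}
    (hσ : MDifferentiableAt 𝓘(ℝ, Rn n) (𝓘(ℝ, Rn n).prod 𝓘(ℝ, F))
      (fun x => TotalSpace.mk' F x (σ x)) y)
    (hτ : MDifferentiableAt 𝓘(ℝ, Rn n) (𝓘(ℝ, Rn n).prod 𝓘(ℝ, F))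
      (fun x => TotalSpace.mk' F x (τ x)) y)
    (h : ∀ᶠ z in nhds y, σ z = τ z) :
    nabla D j σ y = nabla D j τ y :=
  congrArg (fun L : Rn n →L[ℝ] V y => L (coordVec j))
    (D.isCovariantDerivativeOnUniv.congr_of_eventuallyEq hσ hτ Filter.univ_mem h)

lemma mdifferentiableAt_sum {ι : Type*} (s : Finset ι) (σ : ι → Π x, V x) {y : Rn n}
    (h : ∀ a, MDifferentiableAt 𝓘(ℝ, Rn n) (𝓘(ℝ, Rn n).prod 𝓘(ℝ, F))
      (fun x => TotalSpace.mk' F x (σ a x)) y) :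
    MDifferentiableAt 𝓘(ℝ, Rn n) (𝓘(ℝ, Rn n).prod 𝓘(ℝ, F))
      (fun x => TotalSpace.mk' F x ((∑ a ∈ s, σ a) x)) y := by
  have := MDifferentiableAt.sum_section (I := 𝓘(ℝ, Rn n)) (F := F) (s := s) (t := σ) (x₀ := y)
    (fun i _ => h i)
  simpa using! this

lemma nabla_sum_apply (D : CovariantDerivative 𝓘(ℝ, Rn n) F V) (j : Fin n) {ι : Type*}
    (s : Finset ι) (σ : ι → Π x, V x) {y : Rn n}
    (h : ∀ a, MDifferentiableAt 𝓘(ℝ, Rn n) (𝓘(ℝ, Rn n).prod 𝓘(ℝ, F))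
      (fun x => TotalSpace.mk' F x (σ a x)) y) :
    nabla D j (∑ a ∈ s, σ a) y = ∑ a ∈ s, nabla D j (σ a) y := by
  classical
  induction s using Finset.induction_on with
  | empty =>
    simp only [nabla, Finset.sum_empty, D.zero]
    rfl
  | insert a s ha ih =>
    rw [Finset.sum_insert ha, Finset.sum_insert ha, ← ih]
    exact nabla_add_apply D j (h a) (mdifferentiableAt_sum s σ h)

/-- Expand the section in the constant frame and apply the Leibniz rule; the derivatives of the
frame sections are the columns of the connection form. -/
lemma localRep_nabla (D : CovariantDerivative 𝓘(ℝ, Rn n) F V) (j : Fin n) {σ : Π x, V x}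
    {U : Set (Rn n)} (hU : IsOpen U) (hUe : U ⊆ e.baseSet) (hσ : SmoothSectionOn (F := F) σ U)
    {y : Rn n} (hy : y ∈ U) :
    localRep e (nabla D j σ) y =
      fderiv ℝ (localRep e σ) y (coordVec j) + connectionForm e D j y (localRep e σ y) := by
  have hye := hUe hy
  set b := Module.finBasis ℝ F
  set s := localRep e σ with hs
  have hsd : DifferentiableAt ℝ s y :=
    ((((smoothSectionOn_iff hU hUe).1 hσ) y hy).contDiffAt (hU.mem_nhds hy)).differentiableAt
      (by simp)
  have hcd : ∀ a, HasFDerivAt (fun z => b.coord a (s z))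
      ((LinearMap.toContinuousLinearMap (b.coord a)).comp (fderiv ℝ s y)) y := fun a =>
    (LinearMap.toContinuousLinearMap (b.coord a)).hasFDerivAt.comp y hsd.hasFDerivAt
  have hfs : ∀ a, MDifferentiableAt 𝓘(ℝ, Rn n) (𝓘(ℝ, Rn n).prod 𝓘(ℝ, F))
      (fun x => TotalSpace.mk' F x (frameSection e (b a) x)) y := fun a =>
    (smoothSectionOn_frameSection (b a)).mdifferentiableAt e.open_baseSet hye
  have hterm : ∀ a, MDifferentiableAt 𝓘(ℝ, Rn n) (𝓘(ℝ, Rn n).prod 𝓘(ℝ, F))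
      (fun x => TotalSpace.mk' F x (((fun z => b.coord a (s z)) • frameSection e (b a)) x)) y :=
    fun a => MDifferentiableAt.smul_section (hcd a).differentiableAt.mdifferentiableAt (hfs a)
  have hsum : nabla D j σ y =
      ∑ a, nabla D j ((fun z => b.coord a (s z)) • frameSection e (b a)) y := by
    rw [← nabla_sum_apply D j Finset.univ _ hterm]
    refine nabla_congr_apply D j (hσ.mdifferentiableAt hU hy)
      (mdifferentiableAt_sum Finset.univ _ hterm) ?_
    filter_upwards [e.open_baseSet.mem_nhds hye] with z hz
    have h1 : s z = ∑ a, b.coord a (s z) • b a := by simp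
    rw [← symmL_localRep hz σ, ← hs]
    conv_lhs => rw [h1]
    rw [map_sum, Finset.sum_apply]
    refine Finset.sum_congr rfl fun a _ => ?_
    rw [map_smul, e.symmL_apply hz]
    rfl
  rw [localRep_eq_continuousLinearMapAt hye, hsum]
  simp only [fun a => nabla_smul_apply D j (hfs a) (hcd a), map_sum, map_add, map_smul]
  rw [Finset.sum_add_distrib, add_comm]
  congr 1
  · have h2 : ∀ a, e.continuousLinearMapAt ℝ y (frameSection e (b a) y) = b a := fun a => by
      rw [← localRep_eq_continuousLinearMapAt hye, localRep_frameSection hye]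
    simp only [h2]
    exact b.sum_repr _
  · simp [connectionForm, localRep_eq_continuousLinearMapAt hye, b]

end Gauge

/-! ### Calculus of coordinate derivatives. -/

section PartialDerivatives

variable {n : ℕ} {G : Type*} [NormedAddCommGroup G] [NormedSpace ℝ G]

/-- The partial derivative `∂_i f`. -/
def fdir (i : Fin n) (f : Rn n → G) (x : Rn n) : G := fderiv ℝ f x (coordVec i)

variable {U : Set (Rn n)} {x : Rn n} {f g : Rn n → G}

lemma differentiableAt_of_contDiffOn (hU : IsOpen U) (hf : ContDiffOn ℝ ∞ f U) (hx : x ∈ U) :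
    DifferentiableAt ℝ f x :=
  ((hf x hx).contDiffAt (hU.mem_nhds hx)).differentiableAt (by simp)

lemma contDiffOn_fdir (hU : IsOpen U) (hf : ContDiffOn ℝ ∞ f U) (i : Fin n) :
    ContDiffOn ℝ ∞ (fdir i f) U :=
  (hf.fderiv_of_isOpen hU (m := ∞) (by simp)).clm_apply contDiffOn_const

lemma fdir_fdir (hU : IsOpen U) (hf : ContDiffOn ℝ ∞ f U) (hx : x ∈ U) (i j : Fin n) :
    fdir i (fdir j f) x = fderiv ℝ (fderiv ℝ f) x (coordVec i) (coordVec j) := by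
  have h := differentiableAt_of_contDiffOn hU (hf.fderiv_of_isOpen hU (m := ∞) (by simp)) hx
  have h2 := h.hasFDerivAt.clm_apply (hasFDerivAt_const (coordVec j) x)
  have h3 : fdir j f = fun y => fderiv ℝ f y (coordVec j) := rfl
  rw [fdir, h3, h2.fderiv]
  simp

lemma fdir_comm (hU : IsOpen U) (hf : ContDiffOn ℝ ∞ f U) (hx : x ∈ U) (i j : Fin n) :
    fdir i (fdir j f) x = fdir j (fdir i f) x := by
  rw [fdir_fdir hU hf hx, fdir_fdir hU hf hx]
  have h2 : (2 : WithTop ℕ∞) ≤ ∞ := ENat.LEInfty.out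
  exact ((hf x hx).contDiffAt (hU.mem_nhds hx)).isSymmSndFDerivAt
    (by simpa [minSmoothness_of_isRCLikeNormedField] using h2) _ _

lemma fdir_congr (hU : IsOpen U) (h : EqOn f g U) (hx : x ∈ U) (i : Fin n) :
    fdir i f x = fdir i g x := by
  rw [fdir, fdir, (Filter.eventuallyEq_of_mem (hU.mem_nhds hx) h).fderiv_eq]

lemma fdir_add (hf : DifferentiableAt ℝ f x) (hg : DifferentiableAt ℝ g x) (i : Fin n) :
    fdir i (fun y => f y + g y) x = fdir i f x + fdir i g x := by
  simp [fdir, fderiv_fun_add hf hg]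

lemma fdir_sub (hf : DifferentiableAt ℝ f x) (hg : DifferentiableAt ℝ g x) (i : Fin n) :
    fdir i (fun y => f y - g y) x = fdir i f x - fdir i g x := by
  simp [fdir, fderiv_fun_sub hf hg]

lemma fdir_neg (i : Fin n) : fdir i (fun y => -f y) x = -fdir i f x := by
  simp [fdir, fderiv_fun_neg]

lemma fdir_sum {ι : Type*} {s : Finset ι} {f : ι → Rn n → G}
    (hf : ∀ a ∈ s, DifferentiableAt ℝ (f a) x) (i : Fin n) :
    fdir i (fun y => ∑ a ∈ s, f a y) x = ∑ a ∈ s, fdir i (f a) x := by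
  simp [fdir, fderiv_fun_sum hf]

end PartialDerivatives

/-! ### Bianchi and divergence identities for algebra-valued connection forms. -/

section Algebra

variable {n : ℕ} {𝔸 : Type*} [NormedRing 𝔸] [NormedAlgebra ℝ 𝔸]
  {U : Set (Rn n)} {x : Rn n}

lemma fdir_mul {f g : Rn n → 𝔸} (hf : DifferentiableAt ℝ f x) (hg : DifferentiableAt ℝ g x)
    (i : Fin n) : fdir i (fun y => f y * g y) x = fdir i f x * g x + f x * fdir i g x := by
  simp [fdir, fderiv_fun_mul' hf hg]
  abel

/-- The curvature `∂_i a_j - ∂_j a_i + [a_i, a_j]` of the connection form `a`. -/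
def curvForm (a : Fin n → Rn n → 𝔸) (i j : Fin n) (y : Rn n) : 𝔸 :=
  fdir i (a j) y - fdir j (a i) y + (a i y * a j y - a j y * a i y)

/-- The covariant derivative `∂_i X + [a_i, X]`. -/
def covDer (a : Fin n → Rn n → 𝔸) (i : Fin n) (X : Rn n → 𝔸) (y : Rn n) : 𝔸 :=
  fdir i X y + (a i y * X y - X y * a i y)

/-- The divergence `∑_i D_i F_{ij}` of the curvature. -/
def divForm (a : Fin n → Rn n → 𝔸) (j : Fin n) (y : Rn n) : 𝔸 :=
  ∑ i, covDer a i (curvForm a i j) y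

variable {a : Fin n → Rn n → 𝔸}

lemma curvForm_swap (i j : Fin n) (y : Rn n) : curvForm a i j y = -curvForm a j i y := by
  simp only [curvForm]
  abel

lemma covDer_curvForm_swap (k i j : Fin n) (y : Rn n) :
    covDer a k (curvForm a i j) y = -covDer a k (curvForm a j i) y := by
  have : curvForm a i j = fun y => -curvForm a j i y := funext (curvForm_swap i j)
  rw [covDer, this, fdir_neg, covDer]
  noncomm_ring

lemma contDiffOn_curvForm (hU : IsOpen U) (ha : ∀ i, ContDiffOn ℝ ∞ (a i) U) (i j : Fin n) :
    ContDiffOn ℝ ∞ (curvForm a i j) U :=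
  ((contDiffOn_fdir hU (ha j) i).sub (contDiffOn_fdir hU (ha i) j)).add
    (((ha i).mul (ha j)).sub ((ha j).mul (ha i)))

lemma contDiffOn_covDer (hU : IsOpen U) (ha : ∀ i, ContDiffOn ℝ ∞ (a i) U) (i : Fin n)
    {X : Rn n → 𝔸} (hX : ContDiffOn ℝ ∞ X U) : ContDiffOn ℝ ∞ (covDer a i X) U :=
  (contDiffOn_fdir hU hX i).add (((ha i).mul hX).sub (hX.mul (ha i)))

lemma contDiffOn_divForm (hU : IsOpen U) (ha : ∀ i, ContDiffOn ℝ ∞ (a i) U) (j : Fin n) :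
    ContDiffOn ℝ ∞ (divForm a j) U :=
  ContDiffOn.sum fun i _ => contDiffOn_covDer hU ha i (contDiffOn_curvForm hU ha i j)

lemma fdir_curvForm (hU : IsOpen U) (ha : ∀ i, ContDiffOn ℝ ∞ (a i) U) (hx : x ∈ U)
    (k i j : Fin n) :
    fdir k (curvForm a i j) x = fdir k (fdir i (a j)) x - fdir k (fdir j (a i)) x +
      ((fdir k (a i) x * a j x + a i x * fdir k (a j) x) -
        (fdir k (a j) x * a i x + a j x * fdir k (a i) x)) := by
  have h := fun i => differentiableAt_of_contDiffOn hU (ha i) hx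
  have h2 := fun i j => differentiableAt_of_contDiffOn hU (contDiffOn_fdir hU (ha i) j) hx
  have : curvForm a i j = fun y => (fdir i (a j) y - fdir j (a i) y) +
    (a i y * a j y - a j y * a i y) := rfl
  rw [this, fdir_add ((h2 j i).fun_sub (h2 i j))
      (((h i).fun_mul (h j)).fun_sub ((h j).fun_mul (h i))),
    fdir_sub (h2 j i) (h2 i j), fdir_sub ((h i).fun_mul (h j)) ((h j).fun_mul (h i)),
    fdir_mul (h i) (h j), fdir_mul (h j) (h i)]

/-- The second Bianchi identity. -/
lemma bianchi (hU : IsOpen U) (ha : ∀ i, ContDiffOn ℝ ∞ (a i) U) (hx : x ∈ U)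
    (k i j : Fin n) :
    covDer a k (curvForm a i j) x + covDer a i (curvForm a j k) x +
      covDer a j (curvForm a k i) x = 0 := by
  simp only [covDer, fdir_curvForm hU ha hx]
  -- Once the three pairs of mixed second derivatives are matched, the remainder is the Jacobi
  -- identity and cancellation of first-order terms.
  rw [fdir_comm hU (ha j) hx i k, fdir_comm hU (ha k) hx j i, fdir_comm hU (ha i) hx j k]
  simp only [curvForm]
  noncomm_ring

variable {τ : 𝔸 →L[ℝ] ℝ}

/-- The commutator terms add up to `τ([a_k, XY])`, which vanishes for a tracial `τ`. -/
lemma fdir_trace_mul (hτ : ∀ x y, τ (x * y) = τ (y * x)) {X Y : Rn n → 𝔸}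
    (hX : DifferentiableAt ℝ X x) (hY : DifferentiableAt ℝ Y x) (k : Fin n) :
    fdir k (fun y => τ (X y * Y y)) x = τ (covDer a k X x * Y x) + τ (X x * covDer a k Y x) := by
  have h1 : fdir k (fun y => τ (X y * Y y)) x = τ (fdir k (fun y => X y * Y y) x) := by
    have := τ.hasFDerivAt.comp x (hX.fun_mul hY).hasFDerivAt
    simp only [fdir]
    rw [show (fun y => τ (X y * Y y)) = τ ∘ (fun y => X y * Y y) from rfl, this.fderiv]
    rfl
  rw [h1, fdir_mul hX hY, covDer, covDer]
  have h2 := hτ (a k x) (X x * Y x)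
  simp only [map_add, map_sub, mul_add, add_mul, mul_sub, sub_mul] at *
  simp only [← mul_assoc] at *
  linarith

variable (τ) in
/-- The energy density `-∑ τ(F_{ij} F_{ij})`. -/
def energyForm (a : Fin n → Rn n → 𝔸) (y : Rn n) : ℝ :=
  -∑ i, ∑ j, τ (curvForm a i j y * curvForm a i j y)

variable (τ) in
/-- The stress tensor `-∑_j τ(F_{ij} F_{kj})`. -/
def stressForm (a : Fin n → Rn n → 𝔸) (i k : Fin n) (y : Rn n) : ℝ :=
  -∑ j, τ (curvForm a i j y * curvForm a k j y)

variable (τ) in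
/-- The vector field `-∑_j τ(F_{ij} J_j)`, where `J` is the divergence of the curvature. -/
def fluxForm (a : Fin n → Rn n → 𝔸) (i : Fin n) (y : Rn n) : ℝ :=
  -∑ j, τ (curvForm a i j y * divForm a j y)

variable (τ) in
/-- The squared norm `-∑_j τ(J_j J_j)` of the divergence of the curvature. -/
def dissipationForm (a : Fin n → Rn n → 𝔸) (y : Rn n) : ℝ :=
  -∑ j, τ (divForm a j y * divForm a j y)

/-- One half of the product rule is the flux. In the other, antisymmetrizing in the two summed
indices turns `D_k F_{ij}` into `(D_k F_{ij} + D_j F_{ki})/2`, which is `D_i F_{kj}/2` by Bianchi.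
This half, together with the 2 from differentiating the square in the energy, produces the factor
1/4. -/
lemma divergence_stressForm (hτ : ∀ x y, τ (x * y) = τ (y * x)) (hU : IsOpen U)
    (ha : ∀ i, ContDiffOn ℝ ∞ (a i) U) (hx : x ∈ U) (i : Fin n) :
    ∑ k, fdir k (stressForm τ a i k) x = fdir i (energyForm τ a) x / 4 + fluxForm τ a i x := by
  have hF := fun i j => differentiableAt_of_contDiffOn hU (contDiffOn_curvForm hU ha i j) hx
  have hd : ∀ i j k l, DifferentiableAt ℝ (fun y => τ (curvForm a i j y * curvForm a k l y)) x :=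
    fun i j k l => τ.differentiableAt.comp x ((hF i j).mul (hF k l))
  have h1 : ∀ k, fdir k (stressForm τ a i k) x =
      -∑ j, (τ (covDer a k (curvForm a i j) x * curvForm a k j x) +
        τ (curvForm a i j x * covDer a k (curvForm a k j) x)) := fun k => by
    have : stressForm τ a i k = fun y => -∑ j, τ (curvForm a i j y * curvForm a k j y) := rfl
    rw [this, fdir_neg, fdir_sum fun j _ => hd _ _ _ _]
    simp only [fdir_trace_mul (a := a) hτ (hF _ _) (hF _ _)]
  have h2 : fdir i (energyForm τ a) x =
      -∑ k, ∑ j, 2 * τ (covDer a i (curvForm a k j) x * curvForm a k j x) := by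
    have : energyForm τ a = fun y => -∑ k, ∑ j, τ (curvForm a k j y * curvForm a k j y) := rfl
    rw [this, fdir_neg, fdir_sum fun j _ => DifferentiableAt.fun_sum fun k _ => hd _ _ _ _]
    congr 1
    refine Finset.sum_congr rfl fun k _ => ?_
    rw [fdir_sum fun j _ => hd _ _ _ _]
    refine Finset.sum_congr rfl fun j _ => ?_
    rw [fdir_trace_mul (a := a) hτ (hF _ _) (hF _ _), hτ (curvForm a k j x)]
    ring
  have h3 : fluxForm τ a i x =
      -∑ k, ∑ j, τ (curvForm a i j x * covDer a k (curvForm a k j) x) := by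
    rw [fluxForm, Finset.sum_comm]
    simp only [divForm, Finset.mul_sum, map_sum]
  have h4 : ∑ k, ∑ j, τ (covDer a k (curvForm a i j) x * curvForm a k j x) =
      ∑ k, ∑ j, τ (covDer a j (curvForm a k i) x * curvForm a k j x) := by
    rw [Finset.sum_comm]
    refine Finset.sum_congr rfl fun k _ => Finset.sum_congr rfl fun j _ => ?_
    rw [covDer_curvForm_swap j i k, curvForm_swap j k]
    simp
  have h5 : ∑ k, ∑ j, (τ (covDer a k (curvForm a i j) x * curvForm a k j x) +
      τ (covDer a j (curvForm a k i) x * curvForm a k j x)) =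
      ∑ k, ∑ j, τ (covDer a i (curvForm a k j) x * curvForm a k j x) := by
    refine Finset.sum_congr rfl fun k _ => Finset.sum_congr rfl fun j _ => ?_
    rw [← map_add, ← add_mul]
    congr 2
    have := bianchi hU ha hx k i j
    rw [covDer_curvForm_swap i j k] at this
    rw [← sub_eq_zero, ← this]
    abel
  simp only [Finset.sum_add_distrib] at h5
  rw [h2, h3]
  simp only [h1, Finset.sum_add_distrib, Finset.sum_neg_distrib, ← Finset.mul_sum]
  linarith

/-- In the product rule the terms `D_i F_{ij}` sum to the divergence of the curvature, so they pair
to the dissipation. -/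
lemma divergence_fluxForm (hτ : ∀ x y, τ (x * y) = τ (y * x)) (hU : IsOpen U)
    (ha : ∀ i, ContDiffOn ℝ ∞ (a i) U) (hx : x ∈ U) :
    ∑ i, fdir i (fluxForm τ a i) x =
      dissipationForm τ a x - ∑ i, ∑ j, τ (curvForm a i j x * covDer a i (divForm a j) x) := by
  have hF := fun i j => differentiableAt_of_contDiffOn hU (contDiffOn_curvForm hU ha i j) hx
  have hJ := fun j => differentiableAt_of_contDiffOn hU (contDiffOn_divForm hU ha j) hx
  have h1 : ∀ i, fdir i (fluxForm τ a i) x =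
      -∑ j, (τ (covDer a i (curvForm a i j) x * divForm a j x) +
        τ (curvForm a i j x * covDer a i (divForm a j) x)) := fun i => by
    have : fluxForm τ a i = fun y => -∑ j, τ (curvForm a i j y * divForm a j y) := rfl
    have hd : ∀ j, DifferentiableAt ℝ (fun y => τ (curvForm a i j y * divForm a j y)) x :=
      fun j => τ.differentiableAt.comp x ((hF i j).mul (hJ j))
    rw [this, fdir_neg, fdir_sum fun j _ => hd j]
    simp only [fdir_trace_mul (a := a) hτ (hF _ _) (hJ _)]
  have h2 : dissipationForm τ a x =
      -∑ i, ∑ j, τ (covDer a i (curvForm a i j) x * divForm a j x) := by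
    rw [dissipationForm, Finset.sum_comm]
    refine congrArg Neg.neg (Finset.sum_congr rfl fun j _ => ?_)
    rw [← map_sum, ← Finset.sum_mul]
    rfl
  simp only [h1, h2, Finset.sum_add_distrib, Finset.sum_neg_distrib]
  ring

end Algebra

/-! ### Joint smoothness in time and space. -/

section TimeDependent

variable {n : ℕ} {G : Type*} [NormedAddCommGroup G] [NormedSpace ℝ G]

/-- Joint smoothness of a time-dependent map on `I × U`. -/
abbrev JointlySmoothOn (X : ℝ → Rn n → G) (I : Set ℝ) (U : Set (Rn n)) : Prop :=
  ContDiffOn ℝ ∞ (fun p : ℝ × Rn n => X p.1 p.2) (I ×ˢ U)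

variable {I : Set ℝ} {U : Set (Rn n)} {X : ℝ → Rn n → G} {t : ℝ} {x : Rn n}

lemma JointlySmoothOn.slice (h : JointlySmoothOn X I U) (ht : t ∈ I) : ContDiffOn ℝ ∞ (X t) U :=
  ContDiffOn.comp (g := fun p : ℝ × Rn n => X p.1 p.2) (f := fun y => (t, y)) h
    (contDiff_const.prodMk contDiff_id).contDiffOn fun _ hy => ⟨ht, hy⟩

lemma JointlySmoothOn.fdir (hI : UniqueDiffOn ℝ I) (hU : IsOpen U) (h : JointlySmoothOn X I U)
    (i : Fin n) : JointlySmoothOn (fun t => fdir i (X t)) I U := by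
  set f : ℝ × Rn n → G := fun p => X p.1 p.2 with hf
  have h1 : ContDiffOn ℝ ∞ (fun p => fderivWithin ℝ f (I ×ˢ U) p ((0 : ℝ), coordVec i))
      (I ×ˢ U) :=
    (h.fderivWithin (hI.prod hU.uniqueDiffOn) (m := ∞) (by simp)).clm_apply contDiffOn_const
  refine h1.congr ?_
  rintro ⟨t, x⟩ ⟨ht, hx⟩
  have h2 : HasFDerivWithinAt f (fderivWithin ℝ f (I ×ˢ U) (t, x)) (I ×ˢ U) (t, x) :=
    (h.differentiableOn (by simp) (t, x) ⟨ht, hx⟩).hasFDerivWithinAt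
  have h3 : HasFDerivWithinAt (fun y : Rn n => (t, y)) (ContinuousLinearMap.inr ℝ ℝ (Rn n)) U x :=
    (hasFDerivAt_prodMk_right t x).hasFDerivWithinAt
  have h4 := (h2.comp x h3 fun y hy => ⟨ht, hy⟩).hasFDerivAt (hU.mem_nhds hx)
  change fderiv ℝ (X t) x (coordVec i) = _
  have h5 : f ∘ (fun y : Rn n => (t, y)) = X t := rfl
  rw [h5] at h4
  rw [h4.fderiv]
  simp

lemma JointlySmoothOn.contDiffAt (h : JointlySmoothOn X I U) (hU : IsOpen U)
    (ht : t ∈ interior I) (hx : x ∈ U) :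
    ContDiffAt ℝ ∞ (fun p : ℝ × Rn n => X p.1 p.2) (t, x) :=
  (h (t, x) ⟨interior_subset ht, hx⟩).contDiffAt
    (prod_mem_nhds (mem_interior_iff_mem_nhds.1 ht) (hU.mem_nhds hx))

/-- Space and time derivatives commute. -/
lemma hasDerivAt_fdir (h : JointlySmoothOn X I U) (hU : IsOpen U) {Y : Rn n → G}
    (ht : t ∈ interior I) (hx : x ∈ U) (hY : ∀ y ∈ U, HasDerivAt (fun s => X s y) (Y y) t)
    (i : Fin n) :
    HasDerivAt (fun s => YangMills.fdir i (X s) x) (YangMills.fdir i Y x) t := by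
  set f : ℝ × Rn n → G := fun p => X p.1 p.2 with hf
  have hfd : ∀ {s y}, s ∈ interior I → y ∈ U → HasFDerivAt f (fderiv ℝ f (s, y)) (s, y) :=
    fun hs hy => ((h.contDiffAt hU hs hy).differentiableAt (by simp)).hasFDerivAt
  have hcd := h.contDiffAt hU ht hx
  have h2 : HasFDerivAt (fderiv ℝ f) (fderiv ℝ (fderiv ℝ f) (t, x)) (t, x) :=
    ((hcd.fderiv_right (m := ∞) (by simp)).differentiableAt (by simp)).hasFDerivAt
  have hspace : ∀ s ∈ interior I, YangMills.fdir i (X s) x = fderiv ℝ f (s, x) (0, coordVec i) := by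
    intro s hs
    have := (hfd hs hx).comp x (hasFDerivAt_prodMk_right s x)
    change fderiv ℝ (f ∘ fun y : Rn n => (s, y)) x _ = _
    rw [this.fderiv]
    simp
  have htime : ∀ y ∈ U, Y y = fderiv ℝ f (t, y) (1, 0) := by
    intro y hy
    have := ((hfd ht hy).comp t (hasFDerivAt_prodMk_left t y)).hasDerivAt
    rw [(hY y hy).unique this]
    simp
  have h3 : HasDerivAt (fun s => fderiv ℝ f (s, x) ((0 : ℝ), coordVec i))
      (fderiv ℝ (fderiv ℝ f) (t, x) (1, 0) (0, coordVec i)) t := by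
    have h6 : HasDerivAt (fun s => fderiv ℝ f (s, x)) (fderiv ℝ (fderiv ℝ f) (t, x) (1, 0)) t := by
      have h7 := (h2.comp t (hasFDerivAt_prodMk_left t x)).hasDerivAt
      rwa [ContinuousLinearMap.comp_apply, ContinuousLinearMap.inl_apply] at h7
    simpa using h6.clm_apply (hasDerivAt_const t ((0 : ℝ), coordVec i))
  have h4 : YangMills.fdir i Y x = fderiv ℝ (fderiv ℝ f) (t, x) (0, coordVec i) (1, 0) := by
    rw [fdir_congr hU htime hx]
    have := ((h2.comp x (hasFDerivAt_prodMk_right t x)).clm_apply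
      (hasFDerivAt_const ((1 : ℝ), (0 : Rn n)) x))
    rw [YangMills.fdir]
    simp only [Function.comp_def] at this
    rw [this.fderiv]
    simp
  have h5 : (2 : WithTop ℕ∞) ≤ ∞ := ENat.LEInfty.out
  have hsymm : IsSymmSndFDerivAt ℝ f (t, x) := hcd.isSymmSndFDerivAt
    (by simpa [minSmoothness_of_isRCLikeNormedField] using h5)
  rw [h4, hsymm]
  exact h3.congr_of_eventuallyEq
    (Filter.eventuallyEq_of_mem (isOpen_interior.mem_nhds ht) hspace)

end TimeDependent

/-! ### Evolution of curvature and energy under the flow of connection forms. -/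

section Flow

variable {n : ℕ} {𝔸 : Type*} [NormedRing 𝔸] [NormedAlgebra ℝ 𝔸]
  {I : Set ℝ} {U : Set (Rn n)} {t : ℝ} {x : Rn n} {A : ℝ → Fin n → Rn n → 𝔸}

lemma jointlySmoothOn_curvForm (hI : UniqueDiffOn ℝ I) (hU : IsOpen U)
    (hA : ∀ i, JointlySmoothOn (fun t => A t i) I U) (i j : Fin n) :
    JointlySmoothOn (fun t => curvForm (A t) i j) I U :=
  (((hA j).fdir hI hU i).sub ((hA i).fdir hI hU j)).add
    (((hA i).mul (hA j)).sub ((hA j).mul (hA i)))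

lemma jointlySmoothOn_covDer (hI : UniqueDiffOn ℝ I) (hU : IsOpen U)
    (hA : ∀ i, JointlySmoothOn (fun t => A t i) I U) (i : Fin n) {X : ℝ → Rn n → 𝔸}
    (hX : JointlySmoothOn X I U) :
    JointlySmoothOn (fun t => covDer (A t) i (X t)) I U :=
  (hX.fdir hI hU i).add (((hA i).mul hX).sub (hX.mul (hA i)))

lemma jointlySmoothOn_divForm (hI : UniqueDiffOn ℝ I) (hU : IsOpen U)
    (hA : ∀ i, JointlySmoothOn (fun t => A t i) I U) (j : Fin n) :
    JointlySmoothOn (fun t => divForm (A t) j) I U :=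
  ContDiffOn.sum fun i _ => jointlySmoothOn_covDer hI hU hA i
    (jointlySmoothOn_curvForm hI hU hA i j)

variable (τ : 𝔸 →L[ℝ] ℝ)

lemma jointlySmoothOn_energyForm (hI : UniqueDiffOn ℝ I) (hU : IsOpen U)
    (hA : ∀ i, JointlySmoothOn (fun t => A t i) I U) :
    JointlySmoothOn (fun t => energyForm τ (A t)) I U :=
  (ContDiffOn.sum fun i _ => ContDiffOn.sum fun j _ =>
    τ.contDiff.comp_contDiffOn ((jointlySmoothOn_curvForm hI hU hA i j).mul
      (jointlySmoothOn_curvForm hI hU hA i j))).neg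

lemma jointlySmoothOn_stressForm (hI : UniqueDiffOn ℝ I) (hU : IsOpen U)
    (hA : ∀ i, JointlySmoothOn (fun t => A t i) I U) (i k : Fin n) :
    JointlySmoothOn (fun t => stressForm τ (A t) i k) I U :=
  (ContDiffOn.sum fun j _ => τ.contDiff.comp_contDiffOn
    ((jointlySmoothOn_curvForm hI hU hA i j).mul (jointlySmoothOn_curvForm hI hU hA k j))).neg

lemma jointlySmoothOn_fluxForm (hI : UniqueDiffOn ℝ I) (hU : IsOpen U)
    (hA : ∀ i, JointlySmoothOn (fun t => A t i) I U) (i : Fin n) :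
    JointlySmoothOn (fun t => fluxForm τ (A t) i) I U :=
  (ContDiffOn.sum fun j _ => τ.contDiff.comp_contDiffOn
    ((jointlySmoothOn_curvForm hI hU hA i j).mul (jointlySmoothOn_divForm hI hU hA j))).neg

lemma jointlySmoothOn_dissipationForm (hI : UniqueDiffOn ℝ I) (hU : IsOpen U)
    (hA : ∀ i, JointlySmoothOn (fun t => A t i) I U) :
    JointlySmoothOn (fun t => dissipationForm τ (A t)) I U :=
  (ContDiffOn.sum fun j _ => τ.contDiff.comp_contDiffOn
    ((jointlySmoothOn_divForm hI hU hA j).mul (jointlySmoothOn_divForm hI hU hA j))).neg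

/-- The linearization of curvature is the exterior covariant derivative of the variation of the
connection, here the divergence form. -/
lemma hasDerivAt_curvForm (hU : IsOpen U) (hA : ∀ i, JointlySmoothOn (fun t => A t i) I U)
    (hflow : ∀ j, ∀ y ∈ U, HasDerivAt (fun s => A s j y) (divForm (A t) j y) t)
    (ht : t ∈ interior I) (hx : x ∈ U) (i j : Fin n) :
    HasDerivAt (fun s => curvForm (A s) i j x)
      (covDer (A t) i (divForm (A t) j) x - covDer (A t) j (divForm (A t) i) x) t := by
  have h := (((hasDerivAt_fdir (hA j) hU ht hx (hflow j) i).sub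
    (hasDerivAt_fdir (hA i) hU ht hx (hflow i) j))).add
    (((hflow i x hx).mul (hflow j x hx)).sub ((hflow j x hx).mul (hflow i x hx)))
  refine h.congr_deriv ?_
  simp only [covDer]
  abel

variable {τ}

/-- Antisymmetry of `F` makes the two halves of `D_i J_j - D_j J_i` contribute equally, and
differentiating the square doubles again, whence the factor 4. `divergence_fluxForm` then trades
`τ(F_{ij} D_i J_j)` for a divergence and the dissipation. -/
lemma hasDerivAt_energyForm (hτ : ∀ x y, τ (x * y) = τ (y * x)) (hU : IsOpen U)
    (hA : ∀ i, JointlySmoothOn (fun t => A t i) I U)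
    (hflow : ∀ j, ∀ y ∈ U, HasDerivAt (fun s => A s j y) (divForm (A t) j y) t)
    (ht : t ∈ interior I) (hx : x ∈ U) :
    HasDerivAt (fun s => energyForm τ (A s) x)
      (4 * ∑ i, fdir i (fluxForm τ (A t) i) x - 4 * dissipationForm τ (A t) x) t := by
  have hF := hasDerivAt_curvForm hU hA hflow ht hx
  have h1 : HasDerivAt (fun s => energyForm τ (A s) x)
      (-∑ i, ∑ j, τ ((covDer (A t) i (divForm (A t) j) x - covDer (A t) j (divForm (A t) i) x) *
        curvForm (A t) i j x + curvForm (A t) i j x *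
        (covDer (A t) i (divForm (A t) j) x - covDer (A t) j (divForm (A t) i) x))) t :=
    (HasDerivAt.fun_sum fun i _ => HasDerivAt.fun_sum fun j _ =>
      τ.hasFDerivAt.comp_hasDerivAt t ((hF i j).mul (hF i j))).neg
  refine h1.congr_deriv ?_
  rw [divergence_fluxForm hτ hU (fun i => (hA i).slice (interior_subset ht)) hx]
  have h2 : ∀ i j, τ ((covDer (A t) i (divForm (A t) j) x -
      covDer (A t) j (divForm (A t) i) x) * curvForm (A t) i j x + curvForm (A t) i j x *
        (covDer (A t) i (divForm (A t) j) x - covDer (A t) j (divForm (A t) i) x)) =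
      2 * τ (curvForm (A t) i j x * covDer (A t) i (divForm (A t) j) x) +
      2 * τ (curvForm (A t) j i x * covDer (A t) j (divForm (A t) i) x) := fun i j => by
    rw [map_add, hτ, curvForm_swap j i]
    simp only [mul_sub, map_sub, neg_mul, map_neg]
    ring
  simp only [h2, Finset.sum_add_distrib, ← Finset.mul_sum]
  rw [Finset.sum_comm (f := fun i j => τ (curvForm (A t) j i x * covDer (A t) j (divForm (A t) i) x))]
  ring

end Flow

/-! ### Curvature operators in a local trivialization. -/

section GaugeCurvature

variable {n : ℕ} {F : Type*} [NormedAddCommGroup F] [NormedSpace ℝ F] [FiniteDimensional ℝ F]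
  {V : Rn n → Type*} [TopologicalSpace (TotalSpace F V)]
  [∀ x, NormedAddCommGroup (V x)] [∀ x, InnerProductSpace ℝ (V x)]
  [FiberBundle F V] [VectorBundle ℝ F V] [ContMDiffVectorBundle ∞ F V 𝓘(ℝ, Rn n)]
  {e : Trivialization F (TotalSpace.proj : TotalSpace F V → Rn n)}
  [MemTrivializationAtlas e]
  {D : CovariantDerivative 𝓘(ℝ, Rn n) F V} {U : Set (Rn n)} {y : Rn n} {σ : Π x, V x}

lemma IsSmoothFamily.smoothConnection {I : Set ℝ} {D : ℝ → CovariantDerivative 𝓘(ℝ, Rn n) F V}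
    (h : IsSmoothFamily I D) {t : ℝ} (ht : t ∈ I) : SmoothConnection (D t) := by
  intro U σ hU hσ j
  have h1 : ContMDiffOn 𝓘(ℝ, Rn n) 𝓘(ℝ, ℝ × Rn n) ∞ (fun y : Rn n => (t, y)) U :=
    (contDiff_const.prodMk contDiff_id).contMDiff.contMDiffOn
  exact (h U σ hU hσ j).comp h1 fun _ hy => ⟨ht, hy⟩

lemma connectionForm_eq (D : CovariantDerivative 𝓘(ℝ, Rn n) F V) (j : Fin n) (y : Rn n) :
    connectionForm e D j y = ∑ a, ContinuousLinearMap.smulRightL ℝ F F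
      (LinearMap.toContinuousLinearMap ((Module.finBasis ℝ F).coord a))
      (localRep e (nabla D j (frameSection e (Module.finBasis ℝ F a))) y) := rfl

lemma contDiffOn_connectionForm (hD : SmoothConnection D) (j : Fin n) :
    ContDiffOn ℝ ∞ (connectionForm e D j) e.baseSet := by
  have h : ∀ v : F, ContDiffOn ℝ ∞ (localRep e (nabla D j (frameSection e v))) e.baseSet :=
    fun v => (smoothSectionOn_iff e.open_baseSet subset_rfl).1
      (hD _ _ e.open_baseSet (smoothSectionOn_frameSection v) j)
  simp only [funext (connectionForm_eq (e := e) D j)]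
  exact ContDiffOn.sum fun a _ => (ContinuousLinearMap.contDiff _).comp_contDiffOn (h _)

lemma jointlySmoothOn_connectionForm {I : Set ℝ} {D : ℝ → CovariantDerivative 𝓘(ℝ, Rn n) F V}
    (h : IsSmoothFamily I D) (j : Fin n) :
    JointlySmoothOn (fun t => connectionForm e (D t) j) I e.baseSet := by
  have h : ∀ v : F, ContDiffOn ℝ ∞
      (fun p : ℝ × Rn n => localRep e (nabla (D p.1) j (frameSection e v)) p.2)
      (I ×ˢ e.baseSet) := fun v => by
    have h1 := h _ _ e.open_baseSet (smoothSectionOn_frameSection (e := e) v) j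
    rw [e.contMDiffOn_iff (fun p hp => by simpa [e.mem_source] using hp.2)] at h1
    exact contMDiffOn_iff_contDiffOn.1 h1.2
  simp only [JointlySmoothOn, connectionForm_eq]
  exact ContDiffOn.sum fun a _ => (ContinuousLinearMap.contDiff _).comp_contDiffOn (h _)

lemma SmoothSectionOn.mono {U' : Set (Rn n)} (hσ : SmoothSectionOn (F := F) σ U) (h : U' ⊆ U) :
    SmoothSectionOn (F := F) σ U' := ContMDiffOn.mono hσ h

lemma smoothSectionOn_curvatureOp (hD : SmoothConnection D) (hU : IsOpen U)
    (hσ : SmoothSectionOn (F := F) σ U) (i j : Fin n) :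
    SmoothSectionOn (F := F) (curvatureOp D i j σ) U :=
  ContMDiffOn.sub_section (hD U _ hU (hD U σ hU hσ j) i) (hD U _ hU (hD U σ hU hσ i) j)

lemma fdir_clm_apply {L : Rn n → F →L[ℝ] F} {s : Rn n → F} (hL : DifferentiableAt ℝ L y)
    (hs : DifferentiableAt ℝ s y) (i : Fin n) :
    fdir i (fun z => L z (s z)) y = fdir i L y (s y) + L y (fdir i s y) := by
  simp only [fdir]
  rw [(hL.hasFDerivAt.clm_apply hs.hasFDerivAt).fderiv]
  simp [add_comm]

/-- The terms that differentiate the section are symmetric in `i` and `j`, so the commutator acts by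
multiplication with a matrix. -/
lemma localRep_nabla_nabla (hD : SmoothConnection D) (hU : IsOpen U) (hUe : U ⊆ e.baseSet)
    (hσ : SmoothSectionOn (F := F) σ U) (hy : y ∈ U) (i j : Fin n) :
    localRep e (nabla D i (nabla D j σ)) y =
      fdir i (fdir j (localRep e σ)) y + fdir i (connectionForm e D j) y (localRep e σ y) +
      connectionForm e D j y (fdir i (localRep e σ) y) +
      connectionForm e D i y (fdir j (localRep e σ) y) +
      (connectionForm e D i y * connectionForm e D j y) (localRep e σ y) := by
  have hs := (smoothSectionOn_iff hU hUe).1 hσ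
  have hA := differentiableAt_of_contDiffOn hU
    ((contDiffOn_connectionForm (e := e) hD j).mono hUe) hy
  have hsd := differentiableAt_of_contDiffOn hU hs hy
  have hsd2 := differentiableAt_of_contDiffOn hU (contDiffOn_fdir hU hs j) hy
  have h1 : EqOn (localRep e (nabla D j σ)) (fun z => fdir j (localRep e σ) z +
      connectionForm e D j z (localRep e σ z)) U :=
    fun z hz => localRep_nabla D j hU hUe hσ hz
  have h2 := localRep_nabla D i hU hUe (hD U σ hU hσ j) hy
  change _ = fdir i (localRep e (nabla D j σ)) y + _ at h2
  rw [h2, fdir_congr hU h1 hy, h1 hy, fdir_add hsd2 (hA.clm_apply hsd), fdir_clm_apply hA hsd]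
  simp only [map_add, mul_apply_eq_comp]
  abel

lemma localRep_curvatureOp (hD : SmoothConnection D) (hU : IsOpen U) (hUe : U ⊆ e.baseSet)
    (hσ : SmoothSectionOn (F := F) σ U) (hy : y ∈ U) (i j : Fin n) :
    localRep e (curvatureOp D i j σ) y =
      curvForm (connectionForm e D) i j y (localRep e σ y) := by
  rw [curvatureOp, localRep_sub (hUe hy), localRep_nabla_nabla hD hU hUe hσ hy,
    localRep_nabla_nabla hD hU hUe hσ hy,
    fdir_comm hU ((smoothSectionOn_iff hU hUe).1 hσ) hy i j]
  simp only [curvForm, _root_.add_apply, _root_.sub_apply]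
  abel

lemma localRep_divCurvatureOp (hD : SmoothConnection D) (hU : IsOpen U) (hUe : U ⊆ e.baseSet)
    (hσ : SmoothSectionOn (F := F) σ U) (hy : y ∈ U) (j : Fin n) :
    localRep e (divCurvatureOp D j σ) y =
      -(divForm (connectionForm e D) j y (localRep e σ y)) := by
  have hs := (smoothSectionOn_iff hU hUe).1 hσ
  have hA := fun j => (contDiffOn_connectionForm (e := e) hD j).mono hUe
  have hterm : ∀ i, localRep e (nabla D i (curvatureOp D i j σ) - curvatureOp D i j (nabla D i σ)) y
      = covDer (connectionForm e D) i (curvForm (connectionForm e D) i j) y (localRep e σ y) := by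
    intro i
    have h1 : EqOn (localRep e (curvatureOp D i j σ)) (fun z =>
        curvForm (connectionForm e D) i j z (localRep e σ z)) U :=
      fun z hz => localRep_curvatureOp hD hU hUe hσ hz i j
    have h2 := localRep_nabla D i hU hUe (smoothSectionOn_curvatureOp hD hU hσ i j) hy
    change _ = fdir i (localRep e (curvatureOp D i j σ)) y + _ at h2
    have h3 := localRep_nabla D i hU hUe hσ hy
    change _ = fdir i (localRep e σ) y + _ at h3
    rw [localRep_sub (hUe hy), h2, fdir_congr hU h1 hy, h1 hy,
      localRep_curvatureOp hD hU hUe (hD U σ hU hσ i) hy, h3,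
      fdir_clm_apply (differentiableAt_of_contDiffOn hU (contDiffOn_curvForm hU hA i j) hy)
        (differentiableAt_of_contDiffOn hU hs hy)]
    simp only [covDer, _root_.add_apply, _root_.sub_apply, mul_apply_eq_comp, map_add]
    abel
  have hye := hUe hy
  simp only [localRep_eq_continuousLinearMapAt hye] at hterm ⊢
  simp only [divCurvatureOp, Pi.neg_apply, Finset.sum_apply, map_neg, map_sum, hterm, divForm,
    _root_.sum_apply]

end GaugeCurvature

/-! ### Skew-symmetry from metric compatibility. -/

section Metric

variable {n : ℕ} {F : Type*} [NormedAddCommGroup F] [NormedSpace ℝ F] [FiniteDimensional ℝ F]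
  {V : Rn n → Type*} [TopologicalSpace (TotalSpace F V)]
  [∀ x, NormedAddCommGroup (V x)] [∀ x, InnerProductSpace ℝ (V x)]
  [FiberBundle F V] [VectorBundle ℝ F V] [ContMDiffVectorBundle ∞ F V 𝓘(ℝ, Rn n)]
  [IsContMDiffRiemannianBundle 𝓘(ℝ, Rn n) ∞ F V]
  {D : CovariantDerivative 𝓘(ℝ, Rn n) F V} {U : Set (Rn n)} {y : Rn n} {σ ρ : Π x, V x}

lemma contDiffOn_inner (hσ : SmoothSectionOn (F := F) σ U) (hρ : SmoothSectionOn (F := F) ρ U) :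
    ContDiffOn ℝ ∞ (fun z => inner ℝ (σ z) (ρ z)) U :=
  contMDiffOn_iff_contDiffOn.1 (ContMDiffOn.inner_bundle hσ hρ)

lemma fdir_inner (hm : D.IsMetricCompatible) (hU : IsOpen U) (hσ : SmoothSectionOn (F := F) σ U)
    (hρ : SmoothSectionOn (F := F) ρ U) (hy : y ∈ U) (j : Fin n) :
    fdir j (fun z => inner ℝ (σ z) (ρ z)) y =
      inner ℝ (nabla D j σ y) (ρ y) + inner ℝ (σ y) (nabla D j ρ y) := by
  have h := hm.mvfderiv_inner_eq (fun _ => (coordVec j : Rn n))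
    (hσ.mdifferentiableAt hU hy) (hρ.mdifferentiableAt hU hy)
  have h1 : mvfderiv 𝓘(ℝ, Rn n) (fun z => inner ℝ (σ z) (ρ z)) y =
      fderiv ℝ (fun z => inner ℝ (σ z) (ρ z)) y := by
    ext v
    simp only [mvfderiv, mfderiv_eq_fderiv]
    rfl
  rw [h1] at h
  exact h

/-- Differentiate `⟨σ, ρ⟩` twice: the second derivatives commute, and the terms with one derivative
on each factor are symmetric in `i` and `j`. -/
lemma inner_curvatureOp (hm : D.IsMetricCompatible) (hD : SmoothConnection D) (hU : IsOpen U)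
    (hσ : SmoothSectionOn (F := F) σ U) (hρ : SmoothSectionOn (F := F) ρ U) (hy : y ∈ U)
    (i j : Fin n) :
    inner ℝ (curvatureOp D i j σ y) (ρ y) = -inner ℝ (σ y) (curvatureOp D i j ρ y) := by
  have h2 : ∀ i j, fdir i (fdir j (fun z => inner ℝ (σ z) (ρ z))) y =
      (inner ℝ (nabla D i (nabla D j σ) y) (ρ y) + inner ℝ (nabla D j σ y) (nabla D i ρ y)) +
      (inner ℝ (nabla D i σ y) (nabla D j ρ y) + inner ℝ (σ y) (nabla D i (nabla D j ρ) y)) := by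
    intro i j
    have hσ' := hD U σ hU hσ j
    have hρ' := hD U ρ hU hρ j
    rw [fdir_congr hU (fun z hz => fdir_inner hm hU hσ hρ hz j) hy, fdir_add
      (differentiableAt_of_contDiffOn hU (contDiffOn_inner hσ' hρ) hy)
      (differentiableAt_of_contDiffOn hU (contDiffOn_inner hσ hρ') hy),
      fdir_inner hm hU hσ' hρ hy, fdir_inner hm hU hσ hρ' hy]
  have h3 := fdir_comm hU (contDiffOn_inner hσ hρ) hy i j
  rw [h2, h2] at h3
  simp only [curvatureOp, Pi.sub_apply, inner_sub_left, inner_sub_right]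
  linarith

/-- Differentiating the skewness relation of `F_{ij}` shows that `∇_i F_{ij}` is skew as well. -/
lemma inner_divCurvatureOp (hm : D.IsMetricCompatible) (hD : SmoothConnection D) (hU : IsOpen U)
    (hσ : SmoothSectionOn (F := F) σ U) (hρ : SmoothSectionOn (F := F) ρ U) (hy : y ∈ U)
    (j : Fin n) :
    inner ℝ (divCurvatureOp D j σ y) (ρ y) = -inner ℝ (σ y) (divCurvatureOp D j ρ y) := by
  have hterm : ∀ i, inner ℝ ((nabla D i (curvatureOp D i j σ) - curvatureOp D i j (nabla D i σ)) y)
      (ρ y) = -inner ℝ (σ y)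
        ((nabla D i (curvatureOp D i j ρ) - curvatureOp D i j (nabla D i ρ)) y) := by
    intro i
    have hσ' := hD U σ hU hσ i
    have hρ' := hD U ρ hU hρ i
    have hFσ := smoothSectionOn_curvatureOp hD hU hσ i j
    have hFρ := smoothSectionOn_curvatureOp hD hU hρ i j
    have h1 : fdir i (fun z => inner ℝ (curvatureOp D i j σ z) (ρ z)) y =
        -fdir i (fun z => inner ℝ (σ z) (curvatureOp D i j ρ z)) y := by
      rw [← fdir_neg]
      exact fdir_congr hU (fun z hz => inner_curvatureOp hm hD hU hσ hρ hz i j) hy i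
    rw [fdir_inner hm hU hFσ hρ hy, fdir_inner hm hU hσ hFρ hy] at h1
    have h2 := inner_curvatureOp hm hD hU hσ' hρ hy i j
    have h3 := inner_curvatureOp hm hD hU hσ hρ' hy i j
    simp only [Pi.sub_apply, inner_sub_left, inner_sub_right]
    linarith
  simp only [divCurvatureOp, Pi.neg_apply, Finset.sum_apply, inner_neg_left, inner_neg_right,
    sum_inner, inner_sum, hterm, Finset.sum_neg_distrib]

end Metric

/-! ### The Hilbert–Schmidt pairing on a fibre. -/

section HilbertSchmidt

variable {E : Type*} [NormedAddCommGroup E] [InnerProductSpace ℝ E] [FiniteDimensional ℝ E]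

/-- The Hilbert–Schmidt pairing `∑_a ⟨L e_a, M e_a⟩` over an orthonormal basis. -/
def hsInner (L M : E → E) : ℝ :=
  ∑ a, inner ℝ (L (stdOrthonormalBasis ℝ E a)) (M (stdOrthonormalBasis ℝ E a))

lemma hsInner_comm (L M : E → E) : hsInner L M = hsInner M L :=
  Finset.sum_congr rfl fun _ _ => real_inner_comm _ _

lemma hsInner_self_nonneg (L : E → E) : 0 ≤ hsInner L L :=
  Finset.sum_nonneg fun _ _ => real_inner_self_nonneg

lemma hsInner_add_left (L L' M : E → E) : hsInner (L + L') M = hsInner L M + hsInner L' M := by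
  simp [hsInner, inner_add_left, Finset.sum_add_distrib]

lemma hsInner_smul_left (c : ℝ) (L M : E → E) : hsInner (c • L) M = c * hsInner L M := by
  simp [hsInner, real_inner_smul_left, Finset.mul_sum]

lemma hsInner_add_right (L M M' : E → E) : hsInner L (M + M') = hsInner L M + hsInner L M' := by
  simp [hsInner, inner_add_right, Finset.sum_add_distrib]

lemma hsInner_smul_right (c : ℝ) (L M : E → E) : hsInner L (c • M) = c * hsInner L M := by
  simp [hsInner, real_inner_smul_right, Finset.mul_sum]

lemma hsInner_sum_left {ι : Type*} (s : Finset ι) (L : ι → E → E) (M : E → E) :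
    hsInner (∑ i ∈ s, L i) M = ∑ i ∈ s, hsInner (L i) M := by
  simp only [hsInner, Finset.sum_apply, sum_inner]
  exact Finset.sum_comm

lemma hsInner_sum_right {ι : Type*} (s : Finset ι) (L : E → E) (M : ι → E → E) :
    hsInner L (∑ i ∈ s, M i) = ∑ i ∈ s, hsInner L (M i) := by
  simp only [hsInner, Finset.sum_apply, inner_sum]
  exact Finset.sum_comm

/-- This removes the metric from the pairing and makes it computable in any frame. Skewness of one
factor is enough. -/
lemma hsInner_eq_neg_trace {L M : E →ₗ[ℝ] E} (hL : ∀ v w, inner ℝ (L v) w = -inner ℝ v (L w)) :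
    hsInner L M = -LinearMap.trace ℝ E (L * M) := by
  rw [LinearMap.trace_eq_sum_inner _ (stdOrthonormalBasis ℝ E), hsInner, ← Finset.sum_neg_distrib]
  exact Finset.sum_congr rfl fun a _ => hL _ _

lemma hsInner_cauchySchwarz_sum {ι : Type*} (s : Finset ι) (v : ι → ℝ) (L : ι → E → E) :
    hsInner (∑ i ∈ s, v i • L i) (∑ i ∈ s, v i • L i) ≤
      (∑ i ∈ s, v i ^ 2) * ∑ i ∈ s, hsInner (L i) (L i) := by
  have h : ∀ w : E, inner ℝ ((∑ i ∈ s, v i • L i) w) ((∑ i ∈ s, v i • L i) w) ≤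
      (∑ i ∈ s, v i ^ 2) * ∑ i ∈ s, inner ℝ (L i w) (L i w) := by
    intro w
    simp only [real_inner_self_eq_norm_sq, Finset.sum_apply, Pi.smul_apply]
    have h1 : ‖∑ i ∈ s, v i • L i w‖ ≤ ∑ i ∈ s, |v i| * ‖L i w‖ := by
      refine (norm_sum_le _ _).trans_eq (Finset.sum_congr rfl fun i _ => ?_)
      rw [norm_smul, Real.norm_eq_abs]
    refine (pow_le_pow_left₀ (norm_nonneg _) h1 2).trans ?_
    simpa using Finset.sum_mul_sq_le_sq_mul_sq s (fun i => |v i|) fun i => ‖L i w‖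
  have h2 := Finset.sum_le_sum fun a (_ : a ∈ Finset.univ) => h (stdOrthonormalBasis ℝ E a)
  rw [← Finset.mul_sum, Finset.sum_comm] at h2
  exact h2

end HilbertSchmidt

/-! ### The trace as a continuous tracial functional. -/

section TraceForm

variable (F : Type*) [NormedAddCommGroup F] [NormedSpace ℝ F] [FiniteDimensional ℝ F]

/-- The trace on the algebra of continuous endomorphisms. -/
def endTrace : (F →L[ℝ] F) →L[ℝ] ℝ :=
  LinearMap.toContinuousLinearMap (LinearMap.trace ℝ F ∘ₗ ContinuousLinearMap.coeLM ℝ)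

variable {F}

lemma endTrace_apply (A : F →L[ℝ] F) : endTrace F A = LinearMap.trace ℝ F A := rfl

lemma endTrace_mul_comm (A B : F →L[ℝ] F) : endTrace F (A * B) = endTrace F (B * A) :=
  LinearMap.trace_mul_comm ℝ (A : F →ₗ[ℝ] F) B

end TraceForm

/-! ### Stress, flux and dissipation as functions on the base. -/

section Tensors

variable {n : ℕ} {F : Type*} [NormedAddCommGroup F] [NormedSpace ℝ F] [FiniteDimensional ℝ F]
  {V : Rn n → Type*} [TopologicalSpace (TotalSpace F V)]
  [∀ x, NormedAddCommGroup (V x)] [∀ x, InnerProductSpace ℝ (V x)]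
  [FiberBundle F V] [VectorBundle ℝ F V]

/-- The divergence `J_j = ∑_i ∇_i F_{ij}` of the curvature, as a map of the fibre at `x`. -/
def divCurvature (D : CovariantDerivative 𝓘(ℝ, Rn n) F V) (x : Rn n) (j : Fin n) (v : V x) : V x :=
  -divCurvatureOp D j (FiberBundle.extend F v) x

/-- The stress tensor `T_{ik} = ∑_j ⟨F_{ij}, F_{kj}⟩`. -/
def stress (D : CovariantDerivative 𝓘(ℝ, Rn n) F V) (x : Rn n) (i k : Fin n) : ℝ :=
  haveI : FiniteDimensional ℝ (V x) := VectorBundle.finiteDimensional ℝ F V x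
  ∑ j, hsInner (curvature D x i j) (curvature D x k j)

/-- The vector field `S_i = ∑_j ⟨F_{ij}, J_j⟩`. -/
def flux (D : CovariantDerivative 𝓘(ℝ, Rn n) F V) (x : Rn n) (i : Fin n) : ℝ :=
  haveI : FiniteDimensional ℝ (V x) := VectorBundle.finiteDimensional ℝ F V x
  ∑ j, hsInner (curvature D x i j) (divCurvature D x j)

/-- The squared norm `|J|² = ∑_j |J_j|²`. -/
def dissipation (D : CovariantDerivative 𝓘(ℝ, Rn n) F V) (x : Rn n) : ℝ :=
  haveI : FiniteDimensional ℝ (V x) := VectorBundle.finiteDimensional ℝ F V x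
  ∑ j, hsInner (divCurvature D x j) (divCurvature D x j)

variable (D : CovariantDerivative 𝓘(ℝ, Rn n) F V) (x : Rn n)

lemma curvatureNormSq_eq_sum_hsInner :
    haveI : FiniteDimensional ℝ (V x) := VectorBundle.finiteDimensional ℝ F V x
    curvatureNormSq D x = ∑ i, ∑ j, hsInner (curvature D x i j) (curvature D x i j) := by
  simp only [curvatureNormSq, hsInner, real_inner_self_eq_norm_sq]

lemma curvatureNormSq_nonneg : 0 ≤ curvatureNormSq D x := by
  unfold curvatureNormSq
  positivity

lemma stress_symm (i k : Fin n) : stress D x i k = stress D x k i :=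
  have : FiniteDimensional ℝ (V x) := VectorBundle.finiteDimensional ℝ F V x
  Finset.sum_congr rfl fun _ _ => hsInner_comm _ _

lemma sum_stress_self : ∑ i, stress D x i i = curvatureNormSq D x :=
  (curvatureNormSq_eq_sum_hsInner D x).symm

/-- The left side is `∑_j |∑_i v_i F_{ij}|²`; apply Cauchy–Schwarz for each `j`. -/
lemma stress_quadratic_le (v : Fin n → ℝ) :
    ∑ i, ∑ k, v i * v k * stress D x i k ≤ (∑ i, v i ^ 2) * curvatureNormSq D x := by
  have : FiniteDimensional ℝ (V x) := VectorBundle.finiteDimensional ℝ F V x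
  have h := Finset.sum_le_sum fun j (_ : j ∈ Finset.univ) =>
    hsInner_cauchySchwarz_sum Finset.univ v fun i => curvature D x i j
  rw [← Finset.mul_sum, Finset.sum_comm (f := fun j i =>
    hsInner (curvature D x i j) (curvature D x i j)), ← curvatureNormSq_eq_sum_hsInner] at h
  refine le_of_eq_of_le ?_ h
  simp only [hsInner_sum_left, hsInner_sum_right, hsInner_smul_left, hsInner_smul_right, stress,
    Finset.mul_sum]
  rw [Finset.sum_comm_cycle]
  refine Finset.sum_congr rfl fun j _ => ?_
  rw [Finset.sum_comm]
  refine Finset.sum_congr rfl fun i _ => Finset.sum_congr rfl fun k _ => ?_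
  ring_nf

/-- The expression is the square `∑_j |s J_j + ∑_i v_i F_{ij}|²`, expanded. -/
lemma dissipation_flux_stress_nonneg (s : ℝ) (v : Fin n → ℝ) :
    0 ≤ s ^ 2 * dissipation D x + 2 * s * ∑ i, v i * flux D x i +
      ∑ i, ∑ k, v i * v k * stress D x i k := by
  have : FiniteDimensional ℝ (V x) := VectorBundle.finiteDimensional ℝ F V x
  have h := Finset.sum_nonneg fun j (_ : j ∈ Finset.univ) =>
    hsInner_self_nonneg (s • divCurvature D x j + ∑ i, v i • curvature D x i j)
  simp only [hsInner_sum_left, hsInner_sum_right, hsInner_smul_left, hsInner_smul_right,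
    hsInner_add_left, hsInner_add_right, mul_add, Finset.sum_add_distrib] at h
  have h1 : ∑ j, s * (s * hsInner (divCurvature D x j) (divCurvature D x j)) =
      s ^ 2 * dissipation D x := by
    simp only [dissipation, ← Finset.mul_sum]
    ring
  have h2 : ∑ j, s * ∑ i, v i * hsInner (curvature D x i j) (divCurvature D x j) =
      s * ∑ i, v i * flux D x i := by
    rw [← Finset.mul_sum, Finset.sum_comm]
    simp only [flux, Finset.mul_sum]
  have h3 : ∑ j, ∑ i, v i * (s * hsInner (divCurvature D x j) (curvature D x i j)) =
      s * ∑ i, v i * flux D x i := by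
    rw [← h2]
    simp only [Finset.mul_sum]
    refine Finset.sum_congr rfl fun j _ => Finset.sum_congr rfl fun i _ => ?_
    rw [hsInner_comm]
    ring
  have h4 : ∑ j, ∑ i, v i * ∑ k, v k * hsInner (curvature D x k j) (curvature D x i j) =
      ∑ i, ∑ k, v i * v k * stress D x i k := by
    simp only [stress, Finset.mul_sum]
    rw [Finset.sum_comm]
    refine Finset.sum_congr rfl fun i _ => ?_
    rw [Finset.sum_comm]
    refine Finset.sum_congr rfl fun k _ => Finset.sum_congr rfl fun j _ => ?_
    rw [hsInner_comm]
    ring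
  linarith

end Tensors

/-! ### Comparison of the invariant tensors with their local expressions. -/

section GaugeTensors

variable {n : ℕ} {F : Type*} [NormedAddCommGroup F] [NormedSpace ℝ F] [FiniteDimensional ℝ F]
  {V : Rn n → Type*} [TopologicalSpace (TotalSpace F V)]
  [∀ x, NormedAddCommGroup (V x)] [∀ x, InnerProductSpace ℝ (V x)]
  [FiberBundle F V] [VectorBundle ℝ F V] [ContMDiffVectorBundle ∞ F V 𝓘(ℝ, Rn n)]
  {e : Trivialization F (TotalSpace.proj : TotalSpace F V → Rn n)}
  [MemTrivializationAtlas e]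
  {D : CovariantDerivative 𝓘(ℝ, Rn n) F V} {x : Rn n}

/-- The endomorphism of the fibre at `x` given by `A` in a trivialization. -/
def conjFibre (e : Trivialization F (TotalSpace.proj : TotalSpace F V → Rn n))
    [MemTrivializationAtlas e] (x : Rn n) (A : F →L[ℝ] F) : V x →ₗ[ℝ] V x :=
  (e.symmL ℝ x ∘L A ∘L e.continuousLinearMapAt ℝ x : V x →L[ℝ] V x)

/-- Conjugation invariance of the trace is what allows trivializations that are not isometric. -/
lemma trace_conjFibre_mul (hx : x ∈ e.baseSet) (A B : F →L[ℝ] F) :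
    LinearMap.trace ℝ (V x) (conjFibre e x A * conjFibre e x B) = endTrace F (A * B) := by
  have h : conjFibre e x A * conjFibre e x B =
      (e.linearEquivAt ℝ x hx).symm.conj (A * B : F →L[ℝ] F) := by
    ext v
    simp [conjFibre, LinearEquiv.conj_apply, hx]
  rw [h, LinearMap.trace_conj', endTrace_apply]

lemma smoothSectionOn_extend (v : V x) :
    SmoothSectionOn (F := F) (FiberBundle.extend F v) (trivializationAt F V x).baseSet :=
  smoothSectionOn_frameSection (e := trivializationAt F V x) _

lemma smoothSectionOn_extend_inter (v : V x) :
    SmoothSectionOn (F := F) (FiberBundle.extend F v)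
      (e.baseSet ∩ (trivializationAt F V x).baseSet) :=
  (smoothSectionOn_extend v).mono inter_subset_right

/-- The local formula involves the section only through its value at `x`, so the extension built
from the preferred trivialization gives the same endomorphism in every other one. -/
lemma curvature_eq_conjFibre (hD : SmoothConnection D) (hx : x ∈ e.baseSet) (i j : Fin n) :
    curvature D x i j = conjFibre e x (curvForm (connectionForm e D) i j x) := by
  ext v
  have h := localRep_curvatureOp (e := e) hD
    (e.open_baseSet.inter (trivializationAt F V x).open_baseSet) inter_subset_left
    (smoothSectionOn_extend_inter v) ⟨hx, FiberBundle.mem_baseSet_trivializationAt' x⟩ i j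
  rw [curvature, ← symmL_localRep hx (curvatureOp D i j _), h, localRep_eq_continuousLinearMapAt hx,
    FiberBundle.extend_apply_self]
  rfl

lemma divCurvature_eq_conjFibre (hD : SmoothConnection D) (hx : x ∈ e.baseSet) (j : Fin n) :
    divCurvature D x j = conjFibre e x (divForm (connectionForm e D) j x) := by
  ext v
  have h := localRep_divCurvatureOp (e := e) hD
    (e.open_baseSet.inter (trivializationAt F V x).open_baseSet) inter_subset_left
    (smoothSectionOn_extend_inter v) ⟨hx, FiberBundle.mem_baseSet_trivializationAt' x⟩ j
  rw [divCurvature, ← symmL_localRep hx (divCurvatureOp D j _), h,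
    localRep_eq_continuousLinearMapAt hx, FiberBundle.extend_apply_self, map_neg, neg_neg]
  rfl

variable [IsContMDiffRiemannianBundle 𝓘(ℝ, Rn n) ∞ F V]

lemma inner_curvature (hm : D.IsMetricCompatible) (hD : SmoothConnection D) (i j : Fin n)
    (v w : V x) :
    inner ℝ (curvature D x i j v) w = -inner ℝ v (curvature D x i j w) := by
  have h := inner_curvatureOp hm hD (trivializationAt F V x).open_baseSet
    (smoothSectionOn_extend v) (smoothSectionOn_extend w)
    (FiberBundle.mem_baseSet_trivializationAt' x) i j
  simpa using! h

lemma inner_divCurvature (hm : D.IsMetricCompatible) (hD : SmoothConnection D) (j : Fin n)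
    (v w : V x) :
    inner ℝ (divCurvature D x j v) w = -inner ℝ v (divCurvature D x j w) := by
  have h := inner_divCurvatureOp hm hD (trivializationAt F V x).open_baseSet
    (smoothSectionOn_extend v) (smoothSectionOn_extend w)
    (FiberBundle.mem_baseSet_trivializationAt' x) j
  simpa [divCurvature] using congrArg Neg.neg h

lemma hsInner_curvature_curvature (hm : D.IsMetricCompatible) (hD : SmoothConnection D)
    (hx : x ∈ e.baseSet) (i j k l : Fin n) :
    haveI : FiniteDimensional ℝ (V x) := VectorBundle.finiteDimensional ℝ F V x
    hsInner (curvature D x i j) (curvature D x k l) = -endTrace F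
      (curvForm (connectionForm e D) i j x * curvForm (connectionForm e D) k l x) := by
  have : FiniteDimensional ℝ (V x) := VectorBundle.finiteDimensional ℝ F V x
  have h := inner_curvature (x := x) hm hD i j
  rw [curvature_eq_conjFibre hD hx] at h
  rw [curvature_eq_conjFibre hD hx, curvature_eq_conjFibre hD hx, hsInner_eq_neg_trace h,
    trace_conjFibre_mul hx]

lemma hsInner_curvature_divCurvature (hm : D.IsMetricCompatible) (hD : SmoothConnection D)
    (hx : x ∈ e.baseSet) (i j k : Fin n) :
    haveI : FiniteDimensional ℝ (V x) := VectorBundle.finiteDimensional ℝ F V x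
    hsInner (curvature D x i j) (divCurvature D x k) = -endTrace F
      (curvForm (connectionForm e D) i j x * divForm (connectionForm e D) k x) := by
  have : FiniteDimensional ℝ (V x) := VectorBundle.finiteDimensional ℝ F V x
  have h := inner_curvature (x := x) hm hD i j
  rw [curvature_eq_conjFibre hD hx] at h
  rw [curvature_eq_conjFibre hD hx, divCurvature_eq_conjFibre hD hx, hsInner_eq_neg_trace h,
    trace_conjFibre_mul hx]

lemma hsInner_divCurvature_divCurvature (hm : D.IsMetricCompatible) (hD : SmoothConnection D)
    (hx : x ∈ e.baseSet) (j k : Fin n) :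
    haveI : FiniteDimensional ℝ (V x) := VectorBundle.finiteDimensional ℝ F V x
    hsInner (divCurvature D x j) (divCurvature D x k) = -endTrace F
      (divForm (connectionForm e D) j x * divForm (connectionForm e D) k x) := by
  have : FiniteDimensional ℝ (V x) := VectorBundle.finiteDimensional ℝ F V x
  have h := inner_divCurvature (x := x) hm hD j
  rw [divCurvature_eq_conjFibre hD hx] at h
  rw [divCurvature_eq_conjFibre hD hx, divCurvature_eq_conjFibre hD hx, hsInner_eq_neg_trace h,
    trace_conjFibre_mul hx]

lemma curvatureNormSq_eq_energyForm (hm : D.IsMetricCompatible) (hD : SmoothConnection D)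
    (hx : x ∈ e.baseSet) :
    curvatureNormSq D x = energyForm (endTrace F) (connectionForm e D) x := by
  simp only [curvatureNormSq_eq_sum_hsInner, hsInner_curvature_curvature hm hD hx, energyForm,
    Finset.sum_neg_distrib]

lemma stress_eq_stressForm (hm : D.IsMetricCompatible) (hD : SmoothConnection D)
    (hx : x ∈ e.baseSet) (i k : Fin n) :
    stress D x i k = stressForm (endTrace F) (connectionForm e D) i k x := by
  simp only [stress, hsInner_curvature_curvature hm hD hx, stressForm, Finset.sum_neg_distrib]

lemma flux_eq_fluxForm (hm : D.IsMetricCompatible) (hD : SmoothConnection D)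
    (hx : x ∈ e.baseSet) (i : Fin n) :
    flux D x i = fluxForm (endTrace F) (connectionForm e D) i x := by
  simp only [flux, hsInner_curvature_divCurvature hm hD hx, fluxForm, Finset.sum_neg_distrib]

lemma dissipation_eq_dissipationForm (hm : D.IsMetricCompatible) (hD : SmoothConnection D)
    (hx : x ∈ e.baseSet) :
    dissipation D x = dissipationForm (endTrace F) (connectionForm e D) x := by
  simp only [dissipation, hsInner_divCurvature_divCurvature hm hD hx, dissipationForm,
    Finset.sum_neg_distrib]

end GaugeTensors

/-! ### The scalar identities along a Yang–Mills flow. -/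

section FlowTensors

variable {n : ℕ} {F : Type*} [NormedAddCommGroup F] [NormedSpace ℝ F] [FiniteDimensional ℝ F]
  {V : Rn n → Type*} [TopologicalSpace (TotalSpace F V)]
  [∀ x, NormedAddCommGroup (V x)] [∀ x, InnerProductSpace ℝ (V x)]
  [FiberBundle F V] [VectorBundle ℝ F V] [ContMDiffVectorBundle ∞ F V 𝓘(ℝ, Rn n)]
  [IsContMDiffRiemannianBundle 𝓘(ℝ, Rn n) ∞ F V]
  {e : Trivialization F (TotalSpace.proj : TotalSpace F V → Rn n)}
  [MemTrivializationAtlas e]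
  {I : Set ℝ} {D : ℝ → CovariantDerivative 𝓘(ℝ, Rn n) F V} {t : ℝ} {x : Rn n}

lemma sum_coord_smulRight (A : F →L[ℝ] F) :
    ∑ a, ContinuousLinearMap.smulRightL ℝ F F
      (LinearMap.toContinuousLinearMap ((Module.finBasis ℝ F).coord a))
      (A (Module.finBasis ℝ F a)) = A := by
  ext v
  simp only [_root_.sum_apply, ContinuousLinearMap.smulRightL_apply_apply,
    ContinuousLinearMap.smulRight_apply, ← map_smul, ← map_sum]
  exact congrArg A ((Module.finBasis ℝ F).sum_repr v)

/-- Testing the flow equation on the constant frame sections gives the evolution of each column of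
the connection form. -/
lemma IsYangMillsFlow.hasDerivAt_connectionForm (hD : IsYangMillsFlow I D) (ht : t ∈ interior I)
    (hx : x ∈ e.baseSet) (j : Fin n) :
    HasDerivAt (fun s => connectionForm e (D s) j x) (divForm (connectionForm e (D t)) j x) t := by
  have hI := interior_subset ht
  have hs := hD.smooth.smoothConnection hI
  have h : ∀ v : F, HasDerivAt (fun s => localRep e (nabla (D s) j (frameSection e v)) x)
      (divForm (connectionForm e (D t)) j x v) t := by
    intro v
    have h1 := ((hD.evolution t hI x (frameSection e v)
      ((smoothSectionOn_frameSection v x hx).contMDiffAt (e.open_baseSet.mem_nhds hx)) j).hasDerivAt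
      (mem_interior_iff_mem_nhds.1 ht))
    have h2 := (e.continuousLinearMapAt ℝ x).hasFDerivAt.comp_hasDerivAt t h1
    have h3 := localRep_divCurvatureOp hs e.open_baseSet subset_rfl
      (smoothSectionOn_frameSection (e := e) v) hx j
    rw [localRep_frameSection hx, localRep_eq_continuousLinearMapAt hx] at h3
    rw [map_neg, h3, neg_neg] at h2
    simpa only [localRep_eq_continuousLinearMapAt hx] using! h2
  simp only [connectionForm_eq]
  rw [← sum_coord_smulRight (divForm (connectionForm e (D t)) j x)]
  exact HasDerivAt.fun_sum fun a _ =>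
    (ContinuousLinearMap.hasFDerivAt _).comp_hasDerivAt t (h _)

/-- Passes from trivializations to the whole space: the scalar quantities are globally defined, and
smoothness is local. -/
lemma jointlySmoothOn_univ {f : ℝ → Rn n → ℝ}
    (h : ∀ x, ∃ U, IsOpen U ∧ x ∈ U ∧ JointlySmoothOn f I U) : JointlySmoothOn f I univ := by
  rintro ⟨t, x⟩ ⟨ht, -⟩
  obtain ⟨U, hU, hx, hf⟩ := h x
  refine (hf (t, x) ⟨ht, hx⟩).mono_of_mem_nhdsWithin ?_
  have h1 : (univ ×ˢ U : Set (ℝ × Rn n)) ∈ nhds (t, x) :=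
    prod_mem_nhds Filter.univ_mem (hU.mem_nhds hx)
  filter_upwards [mem_nhdsWithin_of_mem_nhds h1, self_mem_nhdsWithin] with p hp1 hp2
  exact ⟨hp2.1, hp1.2⟩

lemma IsYangMillsFlow.jointlySmoothOn_curvatureNormSq (hD : IsYangMillsFlow I D)
    (hI : UniqueDiffOn ℝ I) : JointlySmoothOn (fun t => curvatureNormSq (D t)) I univ := by
  refine jointlySmoothOn_univ fun x => ⟨_, (trivializationAt F V x).open_baseSet,
    FiberBundle.mem_baseSet_trivializationAt' x, ?_⟩
  refine (jointlySmoothOn_energyForm (endTrace F) hI (trivializationAt F V x).open_baseSet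
    (jointlySmoothOn_connectionForm hD.smooth)).congr fun p hp => ?_
  exact curvatureNormSq_eq_energyForm (hD.metric _ hp.1) (hD.smooth.smoothConnection hp.1) hp.2

lemma IsYangMillsFlow.jointlySmoothOn_stress (hD : IsYangMillsFlow I D)
    (hI : UniqueDiffOn ℝ I) (i k : Fin n) :
    JointlySmoothOn (fun t y => stress (D t) y i k) I univ := by
  refine jointlySmoothOn_univ fun x => ⟨_, (trivializationAt F V x).open_baseSet,
    FiberBundle.mem_baseSet_trivializationAt' x, ?_⟩
  refine (jointlySmoothOn_stressForm (endTrace F) hI (trivializationAt F V x).open_baseSet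
    (jointlySmoothOn_connectionForm hD.smooth) i k).congr fun p hp => ?_
  exact stress_eq_stressForm (hD.metric _ hp.1) (hD.smooth.smoothConnection hp.1) hp.2 i k

lemma IsYangMillsFlow.jointlySmoothOn_flux (hD : IsYangMillsFlow I D)
    (hI : UniqueDiffOn ℝ I) (i : Fin n) :
    JointlySmoothOn (fun t y => flux (D t) y i) I univ := by
  refine jointlySmoothOn_univ fun x => ⟨_, (trivializationAt F V x).open_baseSet,
    FiberBundle.mem_baseSet_trivializationAt' x, ?_⟩
  refine (jointlySmoothOn_fluxForm (endTrace F) hI (trivializationAt F V x).open_baseSet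
    (jointlySmoothOn_connectionForm hD.smooth) i).congr fun p hp => ?_
  exact flux_eq_fluxForm (hD.metric _ hp.1) (hD.smooth.smoothConnection hp.1) hp.2 i

lemma IsYangMillsFlow.jointlySmoothOn_dissipation (hD : IsYangMillsFlow I D)
    (hI : UniqueDiffOn ℝ I) : JointlySmoothOn (fun t => dissipation (D t)) I univ := by
  refine jointlySmoothOn_univ fun x => ⟨_, (trivializationAt F V x).open_baseSet,
    FiberBundle.mem_baseSet_trivializationAt' x, ?_⟩
  refine (jointlySmoothOn_dissipationForm (endTrace F) hI (trivializationAt F V x).open_baseSet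
    (jointlySmoothOn_connectionForm hD.smooth)).congr fun p hp => ?_
  exact dissipation_eq_dissipationForm (hD.metric _ hp.1) (hD.smooth.smoothConnection hp.1) hp.2

/-- `∑_k ∂_k T_{ik} = ∂_i |F|² / 4 + S_i`. -/
lemma IsYangMillsFlow.divergence_stress (hD : IsYangMillsFlow I D) (ht : t ∈ I) (x : Rn n)
    (i : Fin n) :
    ∑ k, fdir k (fun y => stress (D t) y i k) x =
      fdir i (curvatureNormSq (D t)) x / 4 + flux (D t) x i := by
  set e := trivializationAt F V x
  have hx : x ∈ e.baseSet := FiberBundle.mem_baseSet_trivializationAt' x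
  have hm := hD.metric t ht
  have hs := hD.smooth.smoothConnection ht
  have h := divergence_stressForm (endTrace_mul_comm (F := F)) e.open_baseSet
    (fun i => contDiffOn_connectionForm (e := e) hs i) hx i
  rw [flux_eq_fluxForm hm hs hx, fdir_congr e.open_baseSet
    (fun y hy => curvatureNormSq_eq_energyForm hm hs hy) hx, ← h]
  exact Finset.sum_congr rfl fun k _ => fdir_congr e.open_baseSet
    (fun y hy => stress_eq_stressForm hm hs hy i k) hx k

/-- `∂_t |F|² = 4 ∑_i ∂_i S_i - 4 |J|²`. -/
lemma IsYangMillsFlow.hasDerivAt_curvatureNormSq (hD : IsYangMillsFlow I D)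
    (ht : t ∈ interior I) (x : Rn n) :
    HasDerivAt (fun s => curvatureNormSq (D s) x)
      (4 * ∑ i, fdir i (fun y => flux (D t) y i) x - 4 * dissipation (D t) x) t := by
  set e := trivializationAt F V x
  have hx : x ∈ e.baseSet := FiberBundle.mem_baseSet_trivializationAt' x
  have hI := interior_subset ht
  have hm := hD.metric t hI
  have hs := hD.smooth.smoothConnection hI
  have h := hasDerivAt_energyForm (endTrace_mul_comm (F := F)) e.open_baseSet
    (jointlySmoothOn_connectionForm (e := e) hD.smooth)
    (fun j y hy => hD.hasDerivAt_connectionForm ht hy j) ht hx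
  rw [dissipation_eq_dissipationForm hm hs hx, Finset.sum_congr rfl fun i _ =>
    fdir_congr e.open_baseSet (fun y hy => flux_eq_fluxForm hm hs hy i) hx i]
  refine h.congr_of_eventuallyEq (Filter.eventuallyEq_of_mem (isOpen_interior.mem_nhds ht)
    fun s hs => ?_)
  exact curvatureNormSq_eq_energyForm (hD.metric s (interior_subset hs))
    (hD.smooth.smoothConnection (interior_subset hs)) hx

end FlowTensors

/-! ### The weighted differential inequality, with the bundle forgotten. -/

section ScalarSystem

variable {n : ℕ}

/-- The scalar quantities of a dissipative flow with energy density `u`, stress tensor `T`,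
flux `S` and dissipation `N`, on the time interval `[a, b]`. -/
structure IsStressFlow (a b : ℝ) (u : ℝ → Rn n → ℝ) (T : ℝ → Rn n → Fin n → Fin n → ℝ)
    (S : ℝ → Rn n → Fin n → ℝ) (N : ℝ → Rn n → ℝ) : Prop where
  smooth_energy : JointlySmoothOn u (Icc a b) univ
  smooth_stress : ∀ i k, JointlySmoothOn (fun t y => T t y i k) (Icc a b) univ
  smooth_flux : ∀ i, JointlySmoothOn (fun t y => S t y i) (Icc a b) univ
  smooth_dissipation : JointlySmoothOn N (Icc a b) univ
  energy_nonneg : ∀ t y, 0 ≤ u t y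
  stress_symm : ∀ t y i k, T t y i k = T t y k i
  trace_stress : ∀ t y, ∑ i, T t y i i = u t y
  stress_le : ∀ t y (v : Fin n → ℝ),
    ∑ i, ∑ k, v i * v k * T t y i k ≤ (∑ i, v i ^ 2) * u t y
  nonneg : ∀ t y (s : ℝ) (v : Fin n → ℝ), 0 ≤ s ^ 2 * N t y + 2 * s * ∑ i, v i * S t y i +
    ∑ i, ∑ k, v i * v k * T t y i k
  divergence_stress : ∀ t ∈ Icc a b, ∀ x i,
    ∑ k, fdir k (fun y => T t y i k) x = fdir i (u t) x / 4 + S t x i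
  hasDerivAt_energy : ∀ t ∈ Ioo a b, ∀ x, HasDerivAt (fun s => u s x)
    (4 * ∑ i, fdir i (fun y => S t y i) x - 4 * N t x) t

/-- The affine vector field `c (x - x₁) + q`. -/
def affineField (c : ℝ) (x₁ : Rn n) (q : Fin n → ℝ) (x : Rn n) (i : Fin n) : ℝ :=
  c * (x i - x₁ i) + q i

/-- A positive weight `H` whose logarithm has gradient `c (x - x₁) + q` and which solves
`∂_t H = -Δ H + 4 c H`. -/
structure IsBackwardWeight (a b : ℝ) (H : ℝ → Rn n → ℝ) (c : ℝ → ℝ) (x₁ : Rn n)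
    (q : Fin n → ℝ) : Prop where
  pos : ∀ t ∈ Icc a b, ∀ x, 0 < H t x
  smooth : JointlySmoothOn H (Icc a b) univ
  continuousOn : ContinuousOn c (Icc a b)
  gradient : ∀ t ∈ Icc a b, ∀ x i, fdir i (H t) x = H t x * affineField (c t) x₁ q x i
  hasDerivAt : ∀ t ∈ Ioo a b, ∀ x, HasDerivAt (fun s => H s x)
    (-(H t x * (∑ i, affineField (c t) x₁ q x i ^ 2 + (n - 4) * c t))) t

lemma contDiff_affineField (c : ℝ) (x₁ : Rn n) (q : Fin n → ℝ) (i : Fin n) :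
    ContDiff ℝ ∞ (fun y => affineField c x₁ q y i) := by
  unfold affineField
  have : ContDiff ℝ ∞ (fun y : Rn n => y i) := (EuclideanSpace.proj (𝕜 := ℝ) i).contDiff
  fun_prop

lemma fdir_affineField (c : ℝ) (x₁ : Rn n) (q : Fin n → ℝ) (x : Rn n) (i k : Fin n) :
    fdir k (fun y => affineField c x₁ q y i) x = if i = k then c else 0 := by
  have h : HasFDerivAt (fun y : Rn n => affineField c x₁ q y i)
      (c • (EuclideanSpace.proj i : Rn n →L[ℝ] ℝ)) x :=
    (((EuclideanSpace.proj (𝕜 := ℝ) i).hasFDerivAt.sub_const (x₁ i)).const_mul c).add_const (q i)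
  rw [fdir, h.fderiv]
  simp [coordVec]

variable {a b : ℝ} {u : ℝ → Rn n → ℝ} {T : ℝ → Rn n → Fin n → Fin n → ℝ}
  {S : ℝ → Rn n → Fin n → ℝ} {N : ℝ → Rn n → ℝ} {H : ℝ → Rn n → ℝ} {c : ℝ → ℝ} {x₁ : Rn n}
  {q : Fin n → ℝ} {φ : Rn n → ℝ} {t : ℝ} {x : Rn n}

/-- The vector field `4 S + 4 T p - u p`, with `p` the logarithmic gradient of the weight. -/
def fluxCorrection (u : ℝ → Rn n → ℝ) (T : ℝ → Rn n → Fin n → Fin n → ℝ)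
    (S : ℝ → Rn n → Fin n → ℝ) (c : ℝ → ℝ) (x₁ : Rn n) (q : Fin n → ℝ) (t : ℝ) (y : Rn n)
    (i : Fin n) : ℝ :=
  4 * S t y i + 4 * ∑ k, affineField (c t) x₁ q y k * T t y i k -
    affineField (c t) x₁ q y i * u t y

lemma IsStressFlow.contDiff_fluxCorrection (h : IsStressFlow a b u T S N) (ht : t ∈ Icc a b)
    (i : Fin n) : ContDiff ℝ ∞ (fun y => fluxCorrection u T S c x₁ q t y i) := by
  have hu := contDiffOn_univ.1 (h.smooth_energy.slice ht)
  have hS := contDiffOn_univ.1 ((h.smooth_flux i).slice ht)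
  have hT := fun k => contDiffOn_univ.1 ((h.smooth_stress i k).slice ht)
  have hp := contDiff_affineField (c t) x₁ q
  exact ((contDiff_const.mul hS).add (contDiff_const.mul (ContDiff.sum fun k _ =>
    (hp k).mul (hT k)))).sub ((hp i).mul hu)

lemma fdir_mul_real {f g : Rn n → ℝ} (hf : DifferentiableAt ℝ f x) (hg : DifferentiableAt ℝ g x)
    (i : Fin n) : fdir i (fun y => f y * g y) x = fdir i f x * g x + f x * fdir i g x :=
  fdir_mul hf hg i

lemma fdir_const_mul {f : Rn n → ℝ} (hf : DifferentiableAt ℝ f x) (r : ℝ) (i : Fin n) :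
    fdir i (fun y => r * f y) x = r * fdir i f x := by
  simp [fdir, fderiv_const_mul hf]

/-- The term `-up` in the field is chosen so that `-p·∇u` cancels the `p·∇u` produced by `4
div(Tp)`. What remains of zeroth order comes from `tr T = u` and `div p = nc`. -/
lemma IsStressFlow.divergence_fluxCorrection (h : IsStressFlow a b u T S N) (ht : t ∈ Icc a b) :
    ∑ i, fdir i (fun y => fluxCorrection u T S c x₁ q t y i) x =
      4 * ∑ i, fdir i (fun y => S t y i) x + 4 * ∑ k, affineField (c t) x₁ q x k * S t x k +
        (4 - n) * c t * u t x := by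
  have hd : ∀ {f : Rn n → ℝ}, ContDiffOn ℝ ∞ f univ → DifferentiableAt ℝ f x :=
    fun hf => differentiableAt_of_contDiffOn isOpen_univ hf (mem_univ x)
  have hu := hd (h.smooth_energy.slice ht)
  have hS := fun i => hd ((h.smooth_flux i).slice ht)
  have hT := fun i k => hd ((h.smooth_stress i k).slice ht)
  have hp := fun i => hd (contDiff_affineField (c t) x₁ q i).contDiffOn
  have h1 : ∀ i, fdir i (fun y => fluxCorrection u T S c x₁ q t y i) x =
      4 * fdir i (fun y => S t y i) x + 4 * (c t * T t x i i + ∑ k, affineField (c t) x₁ q x k *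
        fdir i (fun y => T t y i k) x) -
        (c t * u t x + affineField (c t) x₁ q x i * fdir i (u t) x) := by
    intro i
    have hpT := fun k => (hp k).fun_mul (hT i k)
    have hsum := DifferentiableAt.fun_sum fun k (_ : k ∈ Finset.univ) => hpT k
    simp only [fluxCorrection]
    rw [fdir_sub (((hS i).const_mul 4).fun_add (hsum.const_mul 4)) ((hp i).fun_mul hu),
      fdir_add ((hS i).const_mul 4) (hsum.const_mul 4), fdir_const_mul (hS i),
      fdir_const_mul hsum, fdir_sum fun k _ => hpT k, fdir_mul_real (hp i) hu]
    simp only [fdir_mul_real (hp _) (hT i _), fdir_affineField, if_true, Finset.sum_add_distrib,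
      ite_mul, zero_mul, Finset.sum_ite_eq', Finset.mem_univ]
  have h2 : ∑ i, ∑ k, affineField (c t) x₁ q x k * fdir i (fun y => T t y i k) x =
      ∑ k, affineField (c t) x₁ q x k * (fdir k (u t) x / 4 + S t x k) := by
    rw [Finset.sum_comm]
    refine Finset.sum_congr rfl fun k _ => ?_
    rw [← h.divergence_stress t ht, Finset.mul_sum]
    simp only [h.stress_symm t _ _ k]
  have h3 := h.trace_stress t x
  simp only [h1, Finset.sum_sub_distrib, Finset.sum_add_distrib, ← Finset.mul_sum, h2, h3,
    mul_add, Finset.sum_const, Finset.card_univ, Fintype.card_fin, nsmul_eq_mul, mul_div_assoc']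
  rw [← Finset.sum_div]
  ring

/-- The vector field `φ² H (4 S + 4 T p - u p)`. -/
def cutoffField (u : ℝ → Rn n → ℝ) (T : ℝ → Rn n → Fin n → Fin n → ℝ)
    (S : ℝ → Rn n → Fin n → ℝ) (H : ℝ → Rn n → ℝ) (c : ℝ → ℝ) (x₁ : Rn n) (q : Fin n → ℝ)
    (φ : Rn n → ℝ) (t : ℝ) (i : Fin n) (y : Rn n) : ℝ :=
  φ y ^ 2 * (H t y * fluxCorrection u T S c x₁ q t y i)

/-- The time derivative of `φ² u H`. -/
def weightedEnergyDeriv (u : ℝ → Rn n → ℝ) (S : ℝ → Rn n → Fin n → ℝ) (N : ℝ → Rn n → ℝ)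
    (H : ℝ → Rn n → ℝ) (c : ℝ → ℝ) (x₁ : Rn n) (q : Fin n → ℝ)
    (φ : Rn n → ℝ) (t : ℝ) (x : Rn n) : ℝ :=
  φ x ^ 2 * ((4 * ∑ i, fdir i (fun y => S t y i) x - 4 * N t x) * H t x +
    u t x * -(H t x * (∑ i, affineField (c t) x₁ q x i ^ 2 + (n - 4) * c t)))

lemma IsStressFlow.hasDerivAt_weightedEnergy (h : IsStressFlow a b u T S N)
    (hH : IsBackwardWeight a b H c x₁ q) (φ : Rn n → ℝ) (ht : t ∈ Ioo a b) (x : Rn n) :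
    HasDerivAt (fun s => φ x ^ 2 * (u s x * H s x))
      (weightedEnergyDeriv u S N H c x₁ q φ t x) t :=
  ((h.hasDerivAt_energy t ht x).mul (hH.hasDerivAt t ht x)).const_mul _

lemma IsStressFlow.contDiff_cutoffField (h : IsStressFlow a b u T S N)
    (hH : IsBackwardWeight a b H c x₁ q) (hφ : ContDiff ℝ ∞ φ) (ht : t ∈ Icc a b) (i : Fin n) :
    ContDiff ℝ ∞ (cutoffField u T S H c x₁ q φ t i) :=
  (hφ.pow 2).mul ((contDiffOn_univ.1 (hH.smooth.slice ht)).mul (h.contDiff_fluxCorrection ht i))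

lemma IsStressFlow.divergence_cutoffField (h : IsStressFlow a b u T S N)
    (hH : IsBackwardWeight a b H c x₁ q) (hφ : ContDiff ℝ ∞ φ) (ht : t ∈ Icc a b) :
    ∑ i, fdir i (cutoffField u T S H c x₁ q φ t i) x =
      2 * φ x * H t x * ∑ i, fdir i φ x * fluxCorrection u T S c x₁ q t x i +
      φ x ^ 2 * H t x * ∑ i, affineField (c t) x₁ q x i * fluxCorrection u T S c x₁ q t x i +
      φ x ^ 2 * H t x * ∑ i, fdir i (fun y => fluxCorrection u T S c x₁ q t y i) x := by
  have hφd : DifferentiableAt ℝ φ x := (hφ.differentiable (by simp)).differentiableAt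
  have hHd : DifferentiableAt ℝ (H t) x :=
    differentiableAt_of_contDiffOn isOpen_univ (hH.smooth.slice ht) (mem_univ x)
  have hWd := fun i => ((h.contDiff_fluxCorrection (c := c) (x₁ := x₁) (q := q) ht i).differentiable
    (by simp)).differentiableAt (x := x)
  simp only [Finset.mul_sum, ← Finset.sum_add_distrib]
  refine Finset.sum_congr rfl fun i _ => ?_
  have h1 : cutoffField u T S H c x₁ q φ t i =
    fun y => (φ y * φ y) * (H t y * fluxCorrection u T S c x₁ q t y i) := by
    funext y
    rw [cutoffField, pow_two]
  rw [h1, fdir_mul_real (hφd.fun_mul hφd) (hHd.fun_mul (hWd i)), fdir_mul_real hφd hφd,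
    fdir_mul_real hHd (hWd i), hH.gradient t ht]
  ring

/-- The pointwise differential inequality behind the weighted monotonicity. -/
lemma IsStressFlow.weightedEnergyDeriv_le (h : IsStressFlow a b u T S N)
    (hH : IsBackwardWeight a b H c x₁ q) (hφ : ContDiff ℝ ∞ φ) (ht : t ∈ Icc a b) (x : Rn n) :
    weightedEnergyDeriv u S N H c x₁ q φ t x ≤
      ∑ i, fdir i (cutoffField u T S H c x₁ q φ t i) x +
      (4 * ∑ i, fdir i φ x ^ 2 + 2 * φ x * ∑ i, fdir i φ x * affineField (c t) x₁ q x i) *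
        (u t x * H t x) := by
  rw [h.divergence_cutoffField hH hφ ht, h.divergence_fluxCorrection ht, weightedEnergyDeriv]
  set p := affineField (c t) x₁ q x
  set r := fun i => fdir i φ x
  -- The square to complete is `|φJ + (∇φ + φp)⌟F|²`. It absorbs the flux and all stress terms
  -- except `T(∇φ, ∇φ)`, which is bounded by `|∇φ|² u`.
  have hpos := h.nonneg t x (φ x) fun i => r i + φ x * p i
  have hle := h.stress_le t x r
  have hsymm : ∑ i, ∑ k, p i * r k * T t x i k = ∑ i, ∑ k, r i * p k * T t x i k := by
    rw [Finset.sum_comm]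
    refine Finset.sum_congr rfl fun i _ => Finset.sum_congr rfl fun k _ => ?_
    rw [h.stress_symm t x k i]
    ring
  have h1 : ∑ i, (r i + φ x * p i) * S t x i =
      ∑ i, r i * S t x i + φ x * ∑ i, p i * S t x i := by
    rw [Finset.mul_sum, ← Finset.sum_add_distrib]
    exact Finset.sum_congr rfl fun i _ => by ring
  have h2 : ∑ i, ∑ k, (r i + φ x * p i) * (r k + φ x * p k) * T t x i k =
      ∑ i, ∑ k, r i * r k * T t x i k + 2 * φ x * ∑ i, ∑ k, r i * p k * T t x i k +
        φ x ^ 2 * ∑ i, ∑ k, p i * p k * T t x i k := by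
    rw [two_mul, add_mul]
    nth_rewrite 2 [← hsymm]
    simp only [Finset.mul_sum, ← Finset.sum_add_distrib]
    exact Finset.sum_congr rfl fun i _ => Finset.sum_congr rfl fun k _ => by ring
  have hW : ∀ v : Fin n → ℝ, ∑ i, v i * fluxCorrection u T S c x₁ q t x i =
      4 * ∑ i, v i * S t x i + 4 * ∑ i, ∑ k, v i * p k * T t x i k -
        (∑ i, v i * p i) * u t x := by
    intro v
    simp only [Finset.mul_sum, Finset.sum_mul, ← Finset.sum_add_distrib, ← Finset.sum_sub_distrib]
    refine Finset.sum_congr rfl fun i _ => ?_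
    simp only [fluxCorrection, mul_add, mul_sub, Finset.mul_sum]
    congr 1
    · congr 1
      · ring
      · exact Finset.sum_congr rfl fun k _ => by ring
    · ring
  rw [h1, h2] at hpos
  rw [hW r, hW p]
  have hpp : ∑ i, p i * p i = ∑ i, p i ^ 2 := by simp only [pow_two]
  rw [hpp]
  have hHpos := hH.pos t ht x
  have h3 := mul_nonneg hHpos.le hpos
  have h4 := mul_le_mul_of_nonneg_left hle hHpos.le
  nlinarith [h3, h4]

end ScalarSystem

/-! ### Cutoff functions. -/

section Cutoff

variable {n : ℕ}

lemma exists_bound_deriv_smoothTransition :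
    ∃ C : ℝ, 0 ≤ C ∧ ∀ s, |deriv Real.smoothTransition s| ≤ C := by
  have hc : Continuous (deriv Real.smoothTransition) :=
    Real.smoothTransition.contDiff (n := 1).continuous_deriv le_rfl
  obtain ⟨C, hC⟩ := isCompact_Icc.exists_bound_of_continuousOn (s := Icc (0 : ℝ) 1) hc.continuousOn
  refine ⟨max C 0, le_max_right _ _, fun s => ?_⟩
  by_cases hs : s ∈ Icc (0 : ℝ) 1
  · exact (hC s hs).trans (le_max_left _ _)
  · have : deriv Real.smoothTransition s = 0 := by
      rw [mem_Icc, not_and_or, not_le, not_le] at hs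
      rcases hs with hs | hs
      · have : Real.smoothTransition =ᶠ[nhds s] fun _ => 0 := by
          filter_upwards [Iio_mem_nhds hs] with y hy
          exact Real.smoothTransition.zero_of_nonpos (le_of_lt hy)
        rw [this.deriv_eq, deriv_const]
      · have : Real.smoothTransition =ᶠ[nhds s] fun _ => 1 := by
          filter_upwards [Ioi_mem_nhds hs] with y hy
          exact Real.smoothTransition.one_of_one_le (le_of_lt hy)
        rw [this.deriv_eq, deriv_const]
    rw [this, abs_zero]
    exact le_max_right _ _

/-- Smooth cutoff functions `φ` at scale `R` around `x₁`, with radial gradient of size `R⁻¹`. -/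
lemma exists_cutoff : ∃ C : ℝ, 0 ≤ C ∧ ∀ (x₁ : Rn n) (R : ℝ), 1 ≤ R →
    ∃ φ ψ : Rn n → ℝ, ContDiff ℝ ∞ φ ∧ (∀ x, 0 ≤ φ x) ∧ (∀ x, φ x ≤ 1) ∧
      (∀ x, ‖x - x₁‖ ≤ R → φ x = 1) ∧ (∀ x, 2 * R ≤ ‖x - x₁‖ → φ x = 0) ∧
      (∀ x i, fdir i φ x = ψ x * (x i - x₁ i)) ∧ (∀ x, |ψ x| ≤ C / R ^ 2) ∧
      (∀ x, ‖x - x₁‖ < R → ψ x = 0) ∧ (∀ x, 2 * R < ‖x - x₁‖ → ψ x = 0) := by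
  obtain ⟨C, hC0, hC⟩ := exists_bound_deriv_smoothTransition
  -- The factor 2 is the chain-rule factor from differentiating `|x - x₁|²`.
  refine ⟨2 * C, by positivity, fun x₁ R hR => ?_⟩
  have hR0 : 0 < R := by linarith
  -- Using the squared norm keeps the profile smooth at the centre and makes its gradient a multiple
  -- of `x - x₁`. The values are at least 1 for `|x - x₁| ≤ R` and negative for `|x - x₁| ≥ 2R`.
  set s : Rn n → ℝ := fun x => 2 - ‖x - x₁‖ ^ 2 / R ^ 2
  have hsc : ContDiff ℝ ∞ s :=
    contDiff_const.sub (((contDiff_id.sub contDiff_const).norm_sq ℝ).div_const _)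
  have hs1 : ∀ x, HasFDerivAt s (-((R ^ 2)⁻¹ • (2 • innerSL ℝ (x - x₁)))) x := by
    intro x
    have h1 : HasFDerivAt (fun y : Rn n => ‖y - x₁‖ ^ 2) (2 • innerSL ℝ (x - x₁)) x := by
      simpa using ((hasFDerivAt_id x).sub_const x₁).norm_sq
    simpa [s, div_eq_inv_mul] using! (h1.const_mul (R ^ 2)⁻¹).const_sub 2
  have hbig : ∀ x, 2 * R ≤ ‖x - x₁‖ → s x < 0 := by
    intro x hx
    have : (2 * R) ^ 2 ≤ ‖x - x₁‖ ^ 2 := pow_le_pow_left₀ (by positivity) hx 2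
    have h2 : 4 ≤ ‖x - x₁‖ ^ 2 / R ^ 2 := by
      rw [le_div_iff₀ (by positivity)]
      linarith
    simp only [s]
    linarith
  have hsmall : ∀ x, ‖x - x₁‖ ≤ R → 1 ≤ s x := by
    intro x hx
    have : ‖x - x₁‖ ^ 2 ≤ R ^ 2 := pow_le_pow_left₀ (norm_nonneg _) hx 2
    have h2 : ‖x - x₁‖ ^ 2 / R ^ 2 ≤ 1 := by
      rw [div_le_one (by positivity)]
      linarith
    simp only [s]
    linarith
  have hsmall' : ∀ x, ‖x - x₁‖ < R → 1 < s x := by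
    intro x hx
    have : ‖x - x₁‖ ^ 2 < R ^ 2 := pow_lt_pow_left₀ hx (norm_nonneg _) (by norm_num)
    have h2 : ‖x - x₁‖ ^ 2 / R ^ 2 < 1 := by
      rw [div_lt_one (by positivity)]
      linarith
    simp only [s]
    linarith
  refine ⟨fun x => Real.smoothTransition (s x),
    fun x => deriv Real.smoothTransition (s x) * -((R ^ 2)⁻¹ * 2),
    Real.smoothTransition.contDiff.comp hsc, fun x => Real.smoothTransition.nonneg _,
    fun x => Real.smoothTransition.le_one _,
    fun x hx => Real.smoothTransition.one_of_one_le (hsmall x hx),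
    fun x hx => Real.smoothTransition.zero_of_nonpos (hbig x hx).le, ?_, ?_, ?_, ?_⟩
  · intro x i
    have hst : HasDerivAt Real.smoothTransition (deriv Real.smoothTransition (s x)) (s x) :=
      ((Real.smoothTransition.contDiff (n := 1)).differentiable one_ne_zero _).hasDerivAt
    have h2 := hst.comp_hasFDerivAt x (hs1 x)
    change fderiv ℝ (Real.smoothTransition ∘ s) x _ = _
    rw [h2.fderiv]
    simp [coordVec, EuclideanSpace.inner_single_right]
    ring
  · intro x
    rw [abs_mul, abs_neg, abs_of_nonneg (by positivity : 0 ≤ (R ^ 2)⁻¹ * 2), div_eq_inv_mul]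
    have := mul_le_mul_of_nonneg_right (hC (s x)) (by positivity : 0 ≤ (R ^ 2)⁻¹ * 2)
    linarith
  · intro x hx
    have : Real.smoothTransition =ᶠ[nhds (s x)] fun _ => 1 := by
      filter_upwards [Ioi_mem_nhds (hsmall' x hx)] with y hy
      exact Real.smoothTransition.one_of_one_le (le_of_lt hy)
    simp only [this.deriv_eq, deriv_const, zero_mul]
  · intro x hx
    have : Real.smoothTransition =ᶠ[nhds (s x)] fun _ => 0 := by
      filter_upwards [Iio_mem_nhds (hbig x hx.le)] with y hy
      exact Real.smoothTransition.zero_of_nonpos (le_of_lt hy)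
    simp only [this.deriv_eq, deriv_const, zero_mul]

end Cutoff

/-! ### Integration in space and time of the localized inequality. -/

section Integration

variable {n : ℕ}

/-- Integration by parts against the constant function 1. -/
lemma integral_fdir_eq_zero {Y : Rn n → ℝ} (hY : ContDiff ℝ ∞ Y) (hc : HasCompactSupport Y)
    (i : Fin n) : ∫ x, fdir i Y x = 0 := by
  have hd : Continuous (fdir i Y) := (contDiffOn_univ.1
    (contDiffOn_fdir isOpen_univ hY.contDiffOn i)).continuous
  have hdc : HasCompactSupport (fdir i Y) := hc.fderiv_apply ℝ _
  have h := integral_mul_fderiv_eq_neg_fderiv_mul_of_integrable (𝕜 := ℝ) (μ := volume)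
    (f := fun _ : Rn n => (1 : ℝ)) (g := Y) (v := coordVec i) (by simp)
    (by simpa using! hd.integrable_of_hasCompactSupport hdc)
    (by simpa using hY.continuous.integrable_of_hasCompactSupport hc)
    (fun _ _ => differentiableAt_const _) (fun _ _ => (hY.differentiable (by simp)).differentiableAt)
  simpa using! h

lemma integrable_prod_of_continuousOn {a b : ℝ} {f : ℝ → Rn n → ℝ} {K : Set (Rn n)}
    (hK : IsCompact K) (hf : ContinuousOn (fun p : ℝ × Rn n => f p.1 p.2) (Icc a b ×ˢ univ))
    (h0 : ∀ t x, x ∉ K → f t x = 0) :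
    Integrable (fun p : ℝ × Rn n => f p.1 p.2) ((volume.restrict (Icc a b)).prod volume) := by
  have h1 : IntegrableOn (fun p : ℝ × Rn n => f p.1 p.2) (Icc a b ×ˢ K) :=
    (hf.mono (prod_mono_right (subset_univ K))).integrableOn_compact (isCompact_Icc.prod hK)
  have h2 : IntegrableOn (fun p : ℝ × Rn n => f p.1 p.2) (Icc a b ×ˢ univ) := by
    refine h1.of_forall_sdiff_eq_zero (measurableSet_Icc.prod MeasurableSet.univ) ?_
    rintro ⟨t, x⟩ ⟨⟨ht, -⟩, hx⟩
    exact h0 t x fun hxK => hx ⟨ht, hxK⟩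
  rw [IntegrableOn, Measure.volume_eq_prod, ← Measure.prod_restrict, Measure.restrict_univ] at h2
  exact h2

variable {a b : ℝ} {u : ℝ → Rn n → ℝ} {T : ℝ → Rn n → Fin n → Fin n → ℝ}
  {S : ℝ → Rn n → Fin n → ℝ} {N : ℝ → Rn n → ℝ} {H : ℝ → Rn n → ℝ} {c : ℝ → ℝ} {x₁ : Rn n}
  {q : Fin n → ℝ} {φ : Rn n → ℝ}

lemma continuous_slice {f : ℝ → Rn n → ℝ} {I : Set ℝ}
    (hf : ContinuousOn (fun p : ℝ × Rn n => f p.1 p.2) (I ×ˢ univ)) {t : ℝ} (ht : t ∈ I) :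
    Continuous (f t) :=
  hf.comp_continuous (f := fun y : Rn n => (t, y)) (by fun_prop) fun _ => ⟨ht, mem_univ _⟩

/-- The error term produced by the cutoff function. -/
def cutoffError (u : ℝ → Rn n → ℝ) (H : ℝ → Rn n → ℝ) (c : ℝ → ℝ) (x₁ : Rn n) (q : Fin n → ℝ)
    (φ : Rn n → ℝ) (t : ℝ) (x : Rn n) : ℝ :=
  (4 * ∑ i, fdir i φ x ^ 2 + 2 * φ x * ∑ i, fdir i φ x * affineField (c t) x₁ q x i) *
    (u t x * H t x)

lemma continuousOn_affineField (hc : ContinuousOn c (Icc a b)) (i : Fin n) :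
    ContinuousOn (fun p : ℝ × Rn n => affineField (c p.1) x₁ q p.2 i) (Icc a b ×ˢ univ) := by
  have h1 : ContinuousOn (fun p : ℝ × Rn n => c p.1) (Icc a b ×ˢ univ) :=
    hc.comp continuousOn_fst fun p hp => hp.1
  have h2 : Continuous (fun p : ℝ × Rn n => p.2 i) :=
    (EuclideanSpace.proj (𝕜 := ℝ) i).continuous.comp continuous_snd
  exact (h1.mul (h2.sub continuous_const).continuousOn).add continuousOn_const

lemma IsStressFlow.continuousOn_weightedEnergyDeriv (h : IsStressFlow a b u T S N)
    (hH : IsBackwardWeight a b H c x₁ q) (hab : a < b) (hφ : Continuous φ) :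
    ContinuousOn (fun p : ℝ × Rn n => weightedEnergyDeriv u S N H c x₁ q φ p.1 p.2)
      (Icc a b ×ˢ univ) := by
  have hS := fun i => ((h.smooth_flux i).fdir (uniqueDiffOn_Icc hab) isOpen_univ i).continuousOn
  have hp := fun i => continuousOn_affineField (x₁ := x₁) (q := q) hH.continuousOn i
  have hc : ContinuousOn (fun p : ℝ × Rn n => c p.1) (Icc a b ×ˢ univ) :=
    hH.continuousOn.comp continuousOn_fst fun p hp => hp.1
  exact ((hφ.comp continuous_snd).continuousOn.pow 2).mul
    ((((continuousOn_const.mul (continuousOn_finsetSum _ fun i _ => hS i)).sub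
      (continuousOn_const.mul h.smooth_dissipation.continuousOn)).mul hH.smooth.continuousOn).add
      (h.smooth_energy.continuousOn.mul (hH.smooth.continuousOn.mul
        ((continuousOn_finsetSum _ fun i _ => (hp i).pow 2).add (continuousOn_const.mul hc))).neg))

lemma IsStressFlow.continuousOn_cutoffError (h : IsStressFlow a b u T S N)
    (hH : IsBackwardWeight a b H c x₁ q) (hφ : ContDiff ℝ ∞ φ) :
    ContinuousOn (fun p : ℝ × Rn n => cutoffError u H c x₁ q φ p.1 p.2) (Icc a b ×ˢ univ) := by
  have hp := fun i => continuousOn_affineField (x₁ := x₁) (q := q) hH.continuousOn i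
  have hr : ∀ i, ContinuousOn (fun p : ℝ × Rn n => fdir i φ p.2) (Icc a b ×ˢ univ) := fun i =>
    ((contDiffOn_univ.1 (contDiffOn_fdir isOpen_univ hφ.contDiffOn i)).continuous.comp
      continuous_snd).continuousOn
  have hφ' : ContinuousOn (fun p : ℝ × Rn n => φ p.2) (Icc a b ×ˢ univ) :=
    (hφ.continuous.comp continuous_snd).continuousOn
  exact ((continuousOn_const.mul (continuousOn_finsetSum _ fun i _ => (hr i).pow 2)).add
    ((continuousOn_const.mul hφ').mul (continuousOn_finsetSum _ fun i _ => (hr i).mul (hp i)))).mul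
    (h.smooth_energy.continuousOn.mul hH.smooth.continuousOn)

lemma fdir_eq_zero_of_notMem_tsupport {x : Rn n} (hx : x ∉ tsupport φ) (i : Fin n) :
    fdir i φ x = 0 := by
  have : x ∉ Function.support (fderiv ℝ φ) := fun h => hx (support_fderiv_subset ℝ h)
  rw [fdir, Function.notMem_support.1 this, _root_.zero_apply]

lemma IsStressFlow.integral_weightedEnergyDeriv_le (h : IsStressFlow a b u T S N)
    (hH : IsBackwardWeight a b H c x₁ q) (hab : a < b) (hφ : ContDiff ℝ ∞ φ)
    (hφc : HasCompactSupport φ) {t : ℝ} (ht : t ∈ Icc a b) :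
    ∫ x, weightedEnergyDeriv u S N H c x₁ q φ t x ≤ ∫ x, cutoffError u H c x₁ q φ t x := by
  have hφ0 : ∀ x, x ∉ tsupport φ → φ x = 0 := fun x hx => image_eq_zero_of_notMem_tsupport hx
  have hi1 : Integrable (weightedEnergyDeriv u S N H c x₁ q φ t) :=
    (continuous_slice (f := weightedEnergyDeriv u S N H c x₁ q φ)
      (h.continuousOn_weightedEnergyDeriv hH hab hφ.continuous) ht).integrable_of_hasCompactSupport
      (HasCompactSupport.intro hφc fun x hx => by simp [weightedEnergyDeriv, hφ0 x hx])
  have hi2 : Integrable (cutoffError u H c x₁ q φ t) :=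
    (continuous_slice (f := cutoffError u H c x₁ q φ)
      (h.continuousOn_cutoffError hH hφ) ht).integrable_of_hasCompactSupport
      (HasCompactSupport.intro hφc fun x hx => by
        simp [cutoffError, hφ0 x hx, fdir_eq_zero_of_notMem_tsupport hx])
  have hYs := fun i => h.contDiff_cutoffField hH hφ ht i
  have hYc : ∀ i, HasCompactSupport (cutoffField u T S H c x₁ q φ t i) := fun i =>
    HasCompactSupport.intro hφc fun x hx => by simp [cutoffField, hφ0 x hx]
  have hi3 : ∀ i, Integrable (fdir i (cutoffField u T S H c x₁ q φ t i)) := fun i =>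
    (contDiffOn_univ.1 (contDiffOn_fdir isOpen_univ (hYs i).contDiffOn
      i)).continuous.integrable_of_hasCompactSupport ((hYc i).fderiv_apply ℝ _)
  have hi4 := integrable_finsetSum Finset.univ fun i _ => hi3 i
  calc ∫ x, weightedEnergyDeriv u S N H c x₁ q φ t x
      ≤ ∫ x, (∑ i, fdir i (cutoffField u T S H c x₁ q φ t i) x + cutoffError u H c x₁ q φ t x) :=
        integral_mono hi1 (hi4.add hi2) fun x => h.weightedEnergyDeriv_le hH hφ ht x
    _ = ∫ x, cutoffError u H c x₁ q φ t x := by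
        rw [integral_add hi4 hi2, integral_finsetSum _ fun i _ => hi3 i]
        simp [integral_fdir_eq_zero (hYs _) (hYc _)]

/-- The localized weighted monotonicity formula. -/
lemma IsStressFlow.integral_weightedEnergy_le (h : IsStressFlow a b u T S N)
    (hH : IsBackwardWeight a b H c x₁ q) (hab : a < b) (hφ : ContDiff ℝ ∞ φ)
    (hφc : HasCompactSupport φ) :
    ∫ x, φ x ^ 2 * (u b x * H b x) ≤ (∫ x, φ x ^ 2 * (u a x * H a x)) +
      ∫ p : ℝ × Rn n, cutoffError u H c x₁ q φ p.1 p.2 ∂((volume.restrict (Icc a b)).prod volume) := by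
  have hφ0 : ∀ x, x ∉ tsupport φ → φ x = 0 := fun x hx => image_eq_zero_of_notMem_tsupport hx
  have hcd := h.continuousOn_weightedEnergyDeriv hH hab hφ.continuous
  have hw : ContinuousOn (fun p : ℝ × Rn n => φ p.2 ^ 2 * (u p.1 p.2 * H p.1 p.2))
      (Icc a b ×ˢ univ) := ((hφ.continuous.comp continuous_snd).continuousOn.pow 2).mul
    (h.smooth_energy.continuousOn.mul hH.smooth.continuousOn)
  have hwi : ∀ t ∈ Icc a b, Integrable fun x => φ x ^ 2 * (u t x * H t x) := fun t ht =>
    Continuous.integrable_of_hasCompactSupport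
      (continuous_slice (f := fun t x => φ x ^ 2 * (u t x * H t x)) hw ht)
      (HasCompactSupport.intro hφc fun x hx => by simp [hφ0 x hx])
  -- The fundamental theorem of calculus is applied at each fixed `x`, needing the derivative only
  -- at interior times and continuity up to the endpoints. Fubini then avoids differentiating under
  -- the integral.
  have hFTC : ∀ x, φ x ^ 2 * (u b x * H b x) - φ x ^ 2 * (u a x * H a x) =
      ∫ t in Icc a b, weightedEnergyDeriv u S N H c x₁ q φ t x := fun x => by
    have hline : ContinuousOn (fun t : ℝ => (t, x)) (Icc a b) := by fun_prop
    have hmaps : MapsTo (fun t : ℝ => (t, x)) (Icc a b) (Icc a b ×ˢ univ) :=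
      fun t ht => ⟨ht, mem_univ _⟩
    rw [integral_Icc_eq_integral_Ioc, ← intervalIntegral.integral_of_le hab.le]
    refine (intervalIntegral.integral_eq_sub_of_hasDerivAt_of_le hab.le
      (hw.comp hline hmaps) (fun t ht => h.hasDerivAt_weightedEnergy hH φ ht x) ?_).symm
    exact ContinuousOn.intervalIntegrable_of_Icc hab.le (hcd.comp hline hmaps)
  have hint := integrable_prod_of_continuousOn (f := weightedEnergyDeriv u S N H c x₁ q φ) hφc hcd
    fun t x hx => by simp [weightedEnergyDeriv, hφ0 x hx]
  have hint2 := integrable_prod_of_continuousOn (f := cutoffError u H c x₁ q φ) hφc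
    (h.continuousOn_cutoffError hH hφ) fun t x hx => by
      simp [cutoffError, hφ0 x hx, fdir_eq_zero_of_notMem_tsupport hx]
  rw [← sub_le_iff_le_add', ← integral_sub (hwi b (right_mem_Icc.2 hab.le))
    (hwi a (left_mem_Icc.2 hab.le)), integral_prod _ hint2]
  simp only [hFTC]
  rw [← integral_integral_swap (f := weightedEnergyDeriv u S N H c x₁ q φ) hint]
  exact setIntegral_mono_on hint.integral_prod_left hint2.integral_prod_left measurableSet_Icc
    fun t ht => h.integral_weightedEnergyDeriv_le hH hab hφ hφc ht

end Integration

/-! ### Removal of the cutoff. -/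

section Monotonicity

variable {n : ℕ} {a b : ℝ} {u : ℝ → Rn n → ℝ} {T : ℝ → Rn n → Fin n → Fin n → ℝ}
  {S : ℝ → Rn n → Fin n → ℝ} {N : ℝ → Rn n → ℝ} {H : ℝ → Rn n → ℝ} {c : ℝ → ℝ} {x₁ : Rn n}
  {q : Fin n → ℝ}

/-- On the annulus `|∇φ|` is `O(1/R)` and `p` is `O(R)`, so the coefficient of `uH` is bounded
uniformly in `R ≥ 1`. The bound does not decay; the smallness comes later from the indicator of the
region outside radius `R`. -/
lemma abs_cutoffError_le {φ ψ : Rn n → ℝ} {C R B Q t : ℝ} (hR : 1 ≤ R)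
    (hφ0 : ∀ x, 0 ≤ φ x) (hφ1 : ∀ x, φ x ≤ 1)
    (hfdir : ∀ x i, fdir i φ x = ψ x * (x i - x₁ i)) (hψ : ∀ x, |ψ x| ≤ C / R ^ 2)
    (hin : ∀ x, ‖x - x₁‖ < R → ψ x = 0) (hout : ∀ x, 2 * R < ‖x - x₁‖ → ψ x = 0)
    (hc : |c t| ≤ B) (hq : ∑ i, |q i| ≤ Q) (x : Rn n) (huH : 0 ≤ u t x * H t x) :
    |cutoffError u H c x₁ q φ t x| ≤ (16 * C ^ 2 + 8 * C * B + 4 * C * Q) *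
      ({p : ℝ × Rn n | R ≤ ‖p.2 - x₁‖}.indicator (fun p => u p.1 p.2 * H p.1 p.2) (t, x)) := by
  have hR0 : 0 < R := by linarith
  by_cases h0 : ψ x = 0
  · have h1 : ∀ i, fdir i φ x = 0 := fun i => by rw [hfdir, h0, zero_mul]
    simp only [cutoffError, h1]
    have hC : 0 ≤ C := by
      have := (abs_nonneg _).trans (hψ x)
      rwa [le_div_iff₀ (by positivity), zero_mul] at this
    have hB : 0 ≤ B := (abs_nonneg _).trans hc
    have hQ : 0 ≤ Q := (Finset.sum_nonneg fun i _ => abs_nonneg _).trans hq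
    have : 0 ≤ {p : ℝ × Rn n | R ≤ ‖p.2 - x₁‖}.indicator (fun p => u p.1 p.2 * H p.1 p.2) (t, x) :=
      indicator_apply_nonneg fun _ => huH
    simp only [ne_eq, OfNat.ofNat_ne_zero, not_false_eq_true, zero_pow, Finset.sum_const_zero,
      mul_zero, zero_mul, add_zero, abs_zero]
    positivity
  · have h1 : R ≤ ‖x - x₁‖ := not_lt.1 fun h => h0 (hin x h)
    have h2 : ‖x - x₁‖ ≤ 2 * R := not_lt.1 fun h => h0 (hout x h)
    rw [indicator_of_mem (show (t, x) ∈ {p : ℝ × Rn n | R ≤ ‖p.2 - x₁‖} from h1), cutoffError,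
      abs_mul, abs_of_nonneg huH]
    refine mul_le_mul_of_nonneg_right ?_ huH
    set d := ‖x - x₁‖
    have hd0 : 0 ≤ d := norm_nonneg _
    have hsq : ∑ i, (x i - x₁ i) ^ 2 = d ^ 2 := by
      simpa using (EuclideanSpace.real_norm_sq_eq (x - x₁)).symm
    have hS1 : ∑ i, fdir i φ x ^ 2 = (ψ x * d) ^ 2 := by
      simp only [hfdir, mul_pow, ← Finset.mul_sum, hsq]
    have hS2 : ∑ i, fdir i φ x * affineField (c t) x₁ q x i =
        ψ x * (c t * d ^ 2 + ∑ i, (x i - x₁ i) * q i) := by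
      rw [← hsq, Finset.mul_sum, ← Finset.sum_add_distrib, Finset.mul_sum]
      refine Finset.sum_congr rfl fun i _ => ?_
      rw [hfdir, affineField]
      ring
    have hψR : |ψ x| * R ^ 2 ≤ C := by
      have := hψ x
      rwa [le_div_iff₀ (by positivity)] at this
    -- Here `R ≥ 1` enters: it bounds `|ψ| d` by the same scale as `|ψ| R²`.
    have hRR : R ≤ R ^ 2 := by nlinarith
    have hψd : |ψ x| * d ≤ 2 * C := by
      have h3 : |ψ x| * d ≤ |ψ x| * (2 * R ^ 2) :=
        mul_le_mul_of_nonneg_left (by linarith) (abs_nonneg _)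
      linarith
    have hψd2 : |ψ x| * d ^ 2 ≤ 4 * C := by
      have h3 : d ^ 2 ≤ (2 * R) ^ 2 := pow_le_pow_left₀ hd0 h2 2
      have h4 : |ψ x| * d ^ 2 ≤ |ψ x| * (2 * R) ^ 2 :=
        mul_le_mul_of_nonneg_left h3 (abs_nonneg _)
      linarith
    have hlin : |∑ i, (x i - x₁ i) * q i| ≤ d * Q := by
      refine (Finset.abs_sum_le_sum_abs _ _).trans ?_
      refine le_trans ?_ (mul_le_mul_of_nonneg_left hq hd0)
      rw [Finset.mul_sum]
      refine Finset.sum_le_sum fun i _ => ?_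
      rw [abs_mul]
      refine mul_le_mul_of_nonneg_right ?_ (abs_nonneg _)
      exact PiLp.norm_apply_le (x - x₁) i
    have hQ : 0 ≤ Q := (Finset.sum_nonneg fun i _ => abs_nonneg _).trans hq
    have hB : 0 ≤ B := (abs_nonneg _).trans hc
    have hA1 : |4 * (ψ x * d) ^ 2| ≤ 16 * C ^ 2 := by
      have h3 : |ψ x * d| ≤ 2 * C := by rwa [abs_mul, abs_of_nonneg hd0]
      have h4 := pow_le_pow_left₀ (abs_nonneg _) h3 2
      rw [abs_of_nonneg (by positivity)]
      rw [sq_abs] at h4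
      linarith
    have hA2 : |ψ x * (c t * d ^ 2 + ∑ i, (x i - x₁ i) * q i)| ≤ 4 * C * B + 2 * C * Q := by
      rw [abs_mul]
      have h3 : |c t * d ^ 2 + ∑ i, (x i - x₁ i) * q i| ≤ B * d ^ 2 + d * Q := by
        refine (abs_add_le _ _).trans (add_le_add ?_ hlin)
        rw [abs_mul, abs_of_nonneg (sq_nonneg d)]
        exact mul_le_mul_of_nonneg_right hc (sq_nonneg d)
      have h4 := mul_le_mul_of_nonneg_left h3 (abs_nonneg (ψ x))
      have h5 := mul_le_mul_of_nonneg_right hψd2 hB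
      have h6 := mul_le_mul_of_nonneg_right hψd hQ
      linarith
    have hA3 : |2 * φ x * (ψ x * (c t * d ^ 2 + ∑ i, (x i - x₁ i) * q i))| ≤
        8 * C * B + 4 * C * Q := by
      rw [abs_mul, abs_of_nonneg (by linarith [hφ0 x] : 0 ≤ 2 * φ x)]
      have h3 := mul_le_mul_of_nonneg_left hA2 (by linarith [hφ0 x] : 0 ≤ 2 * φ x)
      have h4 : 0 ≤ 4 * C * B + 2 * C * Q := (abs_nonneg _).trans hA2
      have h5 := mul_le_mul_of_nonneg_right (by linarith [hφ1 x] : 2 * φ x ≤ 2) h4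
      linarith
    rw [hS1, hS2]
    refine (abs_add_le _ _).trans ?_
    linarith

lemma lintegral_cutoff_le {f : Rn n → ℝ} (hf : ∀ x, 0 ≤ f x) {φ : Rn n → ℝ}
    (hφ0 : ∀ x, 0 ≤ φ x) (hφ1 : ∀ x, φ x ≤ 1) :
    ∫⁻ x, ENNReal.ofReal (φ x ^ 2 * f x) ≤ ∫⁻ x, ENNReal.ofReal (f x) :=
  lintegral_mono fun x => ENNReal.ofReal_le_ofReal
    (mul_le_of_le_one_left (hf x) (pow_le_one₀ (hφ0 x) (hφ1 x)))

/-- Weighted monotonicity: under a space-time integrability condition, the weighted energy does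
not increase. -/
theorem IsStressFlow.lintegral_weightedEnergy_le (h : IsStressFlow a b u T S N)
    (hH : IsBackwardWeight a b H c x₁ q) (hab : a < b)
    (hfin : ∫⁻ t in Icc a b, ∫⁻ x, ENNReal.ofReal (u t x * H t x) < ⊤) :
    ∫⁻ x, ENNReal.ofReal (u b x * H b x) ≤ ∫⁻ x, ENNReal.ofReal (u a x * H a x) := by
  obtain ⟨C, hC0, hC⟩ := exists_cutoff (n := n)
  obtain ⟨B, hB⟩ := isCompact_Icc.exists_bound_of_continuousOn hH.continuousOn
  have ha : a ∈ Icc a b := left_mem_Icc.2 hab.le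
  have hb : b ∈ Icc a b := right_mem_Icc.2 hab.le
  have hcont : ContinuousOn (fun p : ℝ × Rn n => u p.1 p.2 * H p.1 p.2) (Icc a b ×ˢ univ) :=
    h.smooth_energy.continuousOn.mul hH.smooth.continuousOn
  have hnn : ∀ t ∈ Icc a b, ∀ x, 0 ≤ u t x * H t x := fun t ht x =>
    mul_nonneg (h.energy_nonneg t x) (hH.pos t ht x).le
  set μ : Measure (ℝ × Rn n) := (volume.restrict (Icc a b)).prod volume with hμ
  set g : ℝ × Rn n → ENNReal := fun p => ENNReal.ofReal (u p.1 p.2 * H p.1 p.2) with hg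
  have hμ' : μ = volume.restrict (Icc a b ×ˢ univ) := by
    rw [hμ, Measure.volume_eq_prod, ← Measure.prod_restrict, Measure.restrict_univ]
  have hgm : AEMeasurable g μ := by
    rw [hμ']
    exact (hcont.aemeasurable (measurableSet_Icc.prod MeasurableSet.univ)).ennreal_ofReal
  have hgfin : ∫⁻ p, g p ∂μ ≠ ⊤ := by
    rw [hμ, lintegral_prod _ hgm]
    exact hfin.ne
  have hμmem : ∀ᵐ p ∂μ, p.1 ∈ Icc a b := by
    rw [hμ']
    filter_upwards [ae_restrict_mem (measurableSet_Icc.prod MeasurableSet.univ)] with p hp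
    exact hp.1
  -- The radii are `m + 1` because the cutoff lemma requires radius at least 1.
  set E : ℕ → Set (ℝ × Rn n) := fun m => {p | (m : ℝ) + 1 ≤ ‖p.2 - x₁‖} with hE
  have hEm : ∀ m, MeasurableSet (E m) := fun m =>
    measurableSet_le measurable_const (by fun_prop)
  set K : ℝ := 16 * C ^ 2 + 8 * C * B + 4 * C * ∑ i, |q i| with hK
  set M := μ.withDensity g with hM
  -- The sets decrease to the empty set and the measure with density `uH` is finite, so continuity
  -- from above applies. This is where the integrability hypothesis enters.
  have hlim : Filter.Tendsto (fun m => M (E m)) Filter.atTop (nhds 0) := by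
    have hinter : ⋂ m, E m = ∅ := by
      refine eq_empty_of_forall_notMem fun p hp => ?_
      obtain ⟨m, hm⟩ := exists_nat_gt ‖p.2 - x₁‖
      have := mem_iInter.1 hp m
      simp only [hE, mem_ofPred_eq] at this
      linarith
    have hanti : Antitone E := fun m k hmk p hp => by
      simp only [hE, mem_ofPred_eq] at hp ⊢
      have : (m : ℝ) ≤ k := by exact_mod_cast hmk
      linarith
    have h1 := tendsto_measure_iInter_atTop (μ := M) (s := E)
      (fun m => (hEm m).nullMeasurableSet) hanti ⟨0, by
        rw [hM, withDensity_apply _ (hEm 0)]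
        exact ((setLIntegral_le_lintegral _ _).trans_lt hgfin.lt_top).ne⟩
    rw [hinter, measure_empty] at h1
    exact h1
  have hR : ∀ m : ℕ, (1 : ℝ) ≤ m + 1 := fun m => by
    have : (0 : ℝ) ≤ m := Nat.cast_nonneg m
    linarith
  choose φ ψ hφs hφ0 hφ1 hφin hφout hfdir hψ hψin hψout using fun m : ℕ => hC x₁ (m + 1) (hR m)
  have hφc : ∀ m, HasCompactSupport (φ m) := fun m =>
    HasCompactSupport.intro (isCompact_closedBall x₁ (2 * (m + 1))) fun x hx => by
      rw [Metric.mem_closedBall, dist_eq_norm, not_le] at hx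
      exact hφout m x hx.le
  have hloc : ∀ m, ∫⁻ x, ENNReal.ofReal (φ m x ^ 2 * (u b x * H b x)) ≤
      (∫⁻ x, ENNReal.ofReal (u a x * H a x)) + ENNReal.ofReal K * M (E m) := by
    intro m
    have hint : ∀ t ∈ Icc a b, Integrable fun x => φ m x ^ 2 * (u t x * H t x) := fun t ht =>
      (((hφs m).continuous.pow 2).mul (continuous_slice (f := fun t x => u t x * H t x) hcont
        ht)).integrable_of_hasCompactSupport
        (HasCompactSupport.intro (hφc m) fun x hx => by
          simp [image_eq_zero_of_notMem_tsupport hx])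
    have hofReal : ∀ t ∈ Icc a b, ENNReal.ofReal (∫ x, φ m x ^ 2 * (u t x * H t x)) =
        ∫⁻ x, ENNReal.ofReal (φ m x ^ 2 * (u t x * H t x)) := fun t ht =>
      ofReal_integral_eq_lintegral_ofReal (hint t ht)
        (Filter.Eventually.of_forall fun x => mul_nonneg (sq_nonneg _) (hnn t ht x))
    have herr : ENNReal.ofReal (∫ p : ℝ × Rn n, cutoffError u H c x₁ q (φ m) p.1 p.2 ∂μ) ≤
        ENNReal.ofReal K * M (E m) := by
      refine (ENNReal.ofReal_le_ofReal (le_abs_self _)).trans ?_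
      rw [← Real.enorm_eq_ofReal_abs, hM, withDensity_apply _ (hEm m),
        ← lintegral_indicator (hEm m), ← lintegral_const_mul' _ _ ENNReal.ofReal_ne_top]
      refine (enorm_integral_le_lintegral_enorm _).trans (lintegral_mono_ae ?_)
      filter_upwards [hμmem] with p hp
      have h1 := abs_cutoffError_le (u := u) (H := H) (c := c) (q := q) (hR m) (hφ0 m) (hφ1 m) (hfdir m) (hψ m)
        (hψin m) (hψout m) (hB p.1 hp) le_rfl p.2 (hnn p.1 hp p.2)
      rw [Real.enorm_eq_ofReal_abs]
      refine (ENNReal.ofReal_le_ofReal h1).trans ?_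
      by_cases hpE : p ∈ E m
      · rw [indicator_of_mem hpE, indicator_of_mem (show (p.1, p.2) ∈ _ from hpE),
          ENNReal.ofReal_mul' (hnn p.1 hp p.2)]
      · rw [indicator_of_notMem (show (p.1, p.2) ∉ _ from hpE)]
        simp
    calc ∫⁻ x, ENNReal.ofReal (φ m x ^ 2 * (u b x * H b x))
        = ENNReal.ofReal (∫ x, φ m x ^ 2 * (u b x * H b x)) := (hofReal b hb).symm
      _ ≤ ENNReal.ofReal ((∫ x, φ m x ^ 2 * (u a x * H a x)) +
            ∫ p : ℝ × Rn n, cutoffError u H c x₁ q (φ m) p.1 p.2 ∂μ) :=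
          ENNReal.ofReal_le_ofReal (h.integral_weightedEnergy_le hH hab (hφs m) (hφc m))
      _ ≤ ENNReal.ofReal (∫ x, φ m x ^ 2 * (u a x * H a x)) +
            ENNReal.ofReal (∫ p : ℝ × Rn n, cutoffError u H c x₁ q (φ m) p.1 p.2 ∂μ) :=
          ENNReal.ofReal_add_le
      _ ≤ _ := by
          rw [hofReal a ha]
          exact add_le_add (lintegral_cutoff_le (hnn a ha) (hφ0 m) (hφ1 m)) herr
  -- At each point the cutoffs are eventually 1, so Fatou's lemma recovers the full integral at time
  -- `b`. At time `a` the bound `φ² ≤ 1` suffices, and that integral may be infinite.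
  have hpt : ∀ x, Filter.liminf (fun m => ENNReal.ofReal (φ m x ^ 2 * (u b x * H b x)))
      Filter.atTop = ENNReal.ofReal (u b x * H b x) := by
    intro x
    refine Filter.Tendsto.liminf_eq (tendsto_const_nhds.congr' ?_)
    obtain ⟨k, hk⟩ := exists_nat_gt ‖x - x₁‖
    filter_upwards [Filter.eventually_ge_atTop k] with m hm
    have : (k : ℝ) ≤ m := by exact_mod_cast hm
    rw [hφin m x (by linarith), one_pow, one_mul]
  have hRHS : Filter.Tendsto (fun m => (∫⁻ x, ENNReal.ofReal (u a x * H a x)) +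
      ENNReal.ofReal K * M (E m)) Filter.atTop (nhds (∫⁻ x, ENNReal.ofReal (u a x * H a x))) := by
    have h1 := (ENNReal.Tendsto.const_mul hlim (Or.inr (ENNReal.ofReal_ne_top (r := K)))).const_add
      (∫⁻ x, ENNReal.ofReal (u a x * H a x))
    simpa using h1
  calc ∫⁻ x, ENNReal.ofReal (u b x * H b x)
      = ∫⁻ x, Filter.liminf (fun m => ENNReal.ofReal (φ m x ^ 2 * (u b x * H b x)))
          Filter.atTop := by simp only [hpt]
    _ ≤ Filter.liminf (fun m => ∫⁻ x, ENNReal.ofReal (φ m x ^ 2 * (u b x * H b x)))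
          Filter.atTop := by
        refine lintegral_liminf_le fun m => ?_
        exact (((hφs m).continuous.pow 2).mul (continuous_slice (f := fun t x => u t x * H t x)
          hcont hb)).measurable.ennreal_ofReal
    _ ≤ Filter.liminf (fun m => (∫⁻ x, ENNReal.ofReal (u a x * H a x)) +
          ENNReal.ofReal K * M (E m)) Filter.atTop :=
        Filter.liminf_le_liminf (Filter.Eventually.of_forall hloc)
    _ = _ := hRHS.liminf_eq

end Monotonicity

/-! ### The Gaussian and exponential weights. -/

section Weights

variable {n : ℕ} {a b : ℝ} {w c : ℝ → ℝ} {x₁ : Rn n} {q : Fin n → ℝ}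

/-- The quadratic polynomial `c |x - x₁|² / 2 + ⟨q, x - x₁⟩`. -/
def quadraticExponent (c : ℝ) (x₁ : Rn n) (q : Fin n → ℝ) (x : Rn n) : ℝ :=
  ∑ k, (c / 2 * (x k - x₁ k) ^ 2 + q k * (x k - x₁ k))

lemma hasFDerivAt_quadraticExponent (c : ℝ) (x₁ : Rn n) (q : Fin n → ℝ) (x : Rn n) :
    HasFDerivAt (quadraticExponent c x₁ q)
      (∑ k, affineField c x₁ q x k • (EuclideanSpace.proj k : Rn n →L[ℝ] ℝ)) x := by
  refine HasFDerivAt.fun_sum fun k _ => ?_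
  have h : HasFDerivAt (fun y : Rn n => y k - x₁ k) (EuclideanSpace.proj k : Rn n →L[ℝ] ℝ) x :=
    (EuclideanSpace.proj (𝕜 := ℝ) k).hasFDerivAt.sub_const (x₁ k)
  refine (((h.pow 2).const_mul (c / 2)).add (h.const_mul (q k))).congr_fderiv ?_
  ext v
  simp [affineField]
  ring

/-- Matching coefficients in `∂_t log H = -(|p|² + (n - 4)c)`: the quadratic part forces `c' =
-2c²`, the part constant in `x` determines `w`, and the linear part `2c ⟨q, x - x₁⟩` must vanish as
`q` is independent of time, hence `c q = 0`. The solutions used are `c = 1/(2(t - t₀))` with `q =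
0`, and `c = 0` with arbitrary `q`. -/
lemma isBackwardWeight_exp (hpos : ∀ t ∈ Icc a b, 0 < w t) (hws : ContDiffOn ℝ ∞ w (Icc a b))
    (hcs : ContDiffOn ℝ ∞ c (Icc a b)) (hcq : ∀ t ∈ Icc a b, ∀ i, c t * q i = 0)
    (hc : ∀ t ∈ Ioo a b, HasDerivAt c (-(2 * c t ^ 2)) t)
    (hw : ∀ t ∈ Ioo a b, HasDerivAt w (-(w t * (∑ i, q i ^ 2 + (n - 4) * c t))) t) :
    IsBackwardWeight a b (fun t x => w t * Real.exp (quadraticExponent (c t) x₁ q x)) c x₁ q where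
  pos t ht x := mul_pos (hpos t ht) (Real.exp_pos _)
  smooth := by
    have h1 : MapsTo Prod.fst (Icc a b ×ˢ (univ : Set (Rn n))) (Icc a b) := fun p hp => hp.1
    have hw' := hws.comp contDiff_fst.contDiffOn h1
    have hc' := hcs.comp contDiff_fst.contDiffOn h1
    have hx : ∀ k, ContDiff ℝ ∞ (fun p : ℝ × Rn n => p.2 k - x₁ k) := fun k =>
      ((EuclideanSpace.proj (𝕜 := ℝ) k).contDiff.comp contDiff_snd).sub contDiff_const
    refine hw'.mul (ContDiffOn.exp (ContDiffOn.sum fun k _ => ?_))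
    exact ((hc'.div_const 2).mul ((hx k).pow 2).contDiffOn).add
      (contDiff_const.mul (hx k)).contDiffOn
  continuousOn := hcs.continuousOn
  gradient t _ x i := by
    have h := ((hasFDerivAt_quadraticExponent (c t) x₁ q x).exp).const_mul (w t)
    rw [fdir, h.fderiv]
    simp [coordVec]
    ring
  hasDerivAt t ht x := by
    have h1 : HasDerivAt (fun s => quadraticExponent (c s) x₁ q x)
        (∑ k, -(2 * c t ^ 2) / 2 * (x k - x₁ k) ^ 2) t :=
      HasDerivAt.fun_sum fun k _ =>
        (((hc t ht).div_const 2).mul_const _).add_const _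
    refine ((hw t ht).mul h1.exp).congr_deriv ?_
    have h2 : ∑ i, affineField (c t) x₁ q x i ^ 2 =
        -(∑ k, -(2 * c t ^ 2) / 2 * (x k - x₁ k) ^ 2) + ∑ i, q i ^ 2 := by
      rw [← Finset.sum_neg_distrib, ← Finset.sum_add_distrib]
      refine Finset.sum_congr rfl fun i _ => ?_
      rw [affineField]
      linear_combination 2 * (x i - x₁ i) * hcq t (Ioo_subset_Icc_self ht) i
    rw [h2]
    ring

lemma quadraticExponent_half_inv (s : ℝ) (x₁ x : Rn n) :
    quadraticExponent (1 / (2 * s)) x₁ 0 x = ‖x - x₁‖ ^ 2 / (4 * s) := by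
  have h : 1 / (2 * s) / 2 = 1 / (4 * s) := by
    rw [div_div]
    ring
  simp only [quadraticExponent, h, EuclideanSpace.real_norm_sq_eq, Finset.sum_div, Pi.zero_apply,
    PiLp.sub_apply]
  exact Finset.sum_congr rfl fun k _ => by ring

lemma quadraticExponent_zero_left (y x : Rn n) :
    quadraticExponent 0 0 (fun i => y i) x = inner ℝ y x := by
  simp [quadraticExponent, PiLp.inner_apply, mul_comm]

lemma hasDerivAt_half_inv {t t₀ : ℝ} (ht : t ≠ t₀) :
    HasDerivAt (fun s => 1 / (2 * (s - t₀))) (-(2 * (1 / (2 * (t - t₀))) ^ 2)) t := by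
  have h0 : t - t₀ ≠ 0 := sub_ne_zero.2 ht
  have h : HasDerivAt (fun s => 2 * (s - t₀)) (2 * 1) t :=
    ((hasDerivAt_id t).sub_const t₀).const_mul 2
  refine ((hasDerivAt_const t (1 : ℝ)).div h (by simpa using h0)).congr_deriv ?_
  field_simp
  ring

/-- The weights `(t - t₀)² (4 π σ (t - t₀))^{-n/2} exp (|x - x₀|² / 4 (t - t₀))`, with a sign `σ`
that makes `σ (t - t₀)` positive. -/
lemma isBackwardWeight_gaussian (x₀ : Rn n) (t₀ : ℝ) {σ : ℝ}
    (hσ : ∀ t ∈ Icc a b, 0 < σ * (t - t₀)) :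
    IsBackwardWeight a b (fun t x => (t - t₀) ^ 2 / (4 * Real.pi * (σ * (t - t₀))) ^ ((n : ℝ) / 2) *
      Real.exp (quadraticExponent (1 / (2 * (t - t₀))) x₀ 0 x))
      (fun t => 1 / (2 * (t - t₀))) x₀ 0 := by
  have hne : ∀ t ∈ Icc a b, t - t₀ ≠ 0 := fun t ht h => by simpa [h] using hσ t ht
  have hP : ∀ t ∈ Icc a b, 0 < 4 * Real.pi * (σ * (t - t₀)) := fun t ht =>
    mul_pos (by positivity) (hσ t ht)
  refine isBackwardWeight_exp (fun t ht => ?_) ?_ ?_ (fun t ht i => mul_zero _) (fun t ht => ?_)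
    fun t ht => ?_
  · exact div_pos (by have := hne t ht; positivity) (Real.rpow_pos_of_pos (hP t ht) _)
  · refine ContDiffOn.div (by fun_prop) (fun t ht => ?_)
      fun t ht => (Real.rpow_pos_of_pos (hP t ht) _).ne'
    exact ContDiffWithinAt.rpow_const_of_ne (by fun_prop) (hP t ht).ne'
  · exact ContDiffOn.div (by fun_prop) (by fun_prop) fun t ht => mul_ne_zero two_ne_zero (hne t ht)
  · exact hasDerivAt_half_inv (sub_ne_zero.1 (hne t (Ioo_subset_Icc_self ht)))
  -- As `c = 1/(2(t - t₀))`, the factor `(t - t₀)²` contributes `4c` to the logarithmic derivative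
  -- and the power contributes `-nc`.
  · have h0 := hne t (Ioo_subset_Icc_self ht)
    have hP0 := hP t (Ioo_subset_Icc_self ht)
    have h1 : HasDerivAt (fun s => s - t₀) 1 t := (hasDerivAt_id t).sub_const t₀
    have h2 : HasDerivAt (fun s => 4 * Real.pi * (σ * (s - t₀))) (4 * Real.pi * (σ * 1)) t :=
      (h1.const_mul σ).const_mul _
    have h3 := h2.rpow_const (p := (n : ℝ) / 2) (Or.inl hP0.ne')
    have hr := Real.rpow_pos_of_pos hP0 ((n : ℝ) / 2)
    refine ((h1.pow 2).div h3 hr.ne').congr_deriv ?_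
    rw [Real.rpow_sub_one hP0.ne']
    have hσ0 : σ ≠ 0 := fun h => by simp [h] at hP0
    have hpi := Real.pi_ne_zero
    set r := (4 * Real.pi * (σ * (t - t₀))) ^ ((n : ℝ) / 2)
    have hr0 := hr.ne'
    simp only [Pi.zero_apply]
    field_simp
    simp
    ring

lemma isBackwardWeight_translator (x₀ : Rn n) (t₀ : ℝ) :
    IsBackwardWeight a b (fun t x => Real.exp (-(‖x₀‖ ^ 2 * (t - t₀))) *
      Real.exp (quadraticExponent 0 0 (fun i => x₀ i) x)) (fun _ => 0) 0 fun i => x₀ i := by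
  refine isBackwardWeight_exp (c := fun _ => 0) (fun t ht => Real.exp_pos _) ?_ contDiffOn_const
    (fun t ht i => zero_mul _) (fun t ht => by simpa using hasDerivAt_const t (0 : ℝ)) fun t ht => ?_
  · fun_prop
  · have h1 : HasDerivAt (fun s => -(‖x₀‖ ^ 2 * (s - t₀))) (-(‖x₀‖ ^ 2 * 1)) t :=
      (((hasDerivAt_id t).sub_const t₀).const_mul _).neg
    refine h1.exp.congr_deriv ?_
    rw [← EuclideanSpace.real_norm_sq_eq]
    ring

end Weights

/-! ### From weights to monotone functionals. -/

section Monotone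

variable {n : ℕ} {F : Type*} [NormedAddCommGroup F] [NormedSpace ℝ F] [FiniteDimensional ℝ F]
  {V : Rn n → Type*} [TopologicalSpace (TotalSpace F V)]
  [∀ x, NormedAddCommGroup (V x)] [∀ x, InnerProductSpace ℝ (V x)]
  [FiberBundle F V] [VectorBundle ℝ F V] [ContMDiffVectorBundle ∞ F V 𝓘(ℝ, Rn n)]
  [IsContMDiffRiemannianBundle 𝓘(ℝ, Rn n) ∞ F V]
  {I J : Set ℝ} {D : ℝ → CovariantDerivative 𝓘(ℝ, Rn n) F V} {a b : ℝ}

lemma IsYangMillsFlow.mono (hD : IsYangMillsFlow I D) (hJ : J ⊆ I) : IsYangMillsFlow J D where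
  metric t ht := hD.metric t (hJ ht)
  smooth U σ hU hσ j := (hD.smooth U σ hU hσ j).mono (prod_mono_left hJ)
  evolution t ht x σ hσ j := (hD.evolution t (hJ ht) x σ hσ j).mono hJ

lemma IsYangMillsFlow.isStressFlow (hD : IsYangMillsFlow (Icc a b) D) (hab : a < b) :
    IsStressFlow a b (fun t => curvatureNormSq (D t)) (fun t => stress (D t))
      (fun t => flux (D t)) (fun t => dissipation (D t)) where
  smooth_energy := hD.jointlySmoothOn_curvatureNormSq (uniqueDiffOn_Icc hab)
  smooth_stress := hD.jointlySmoothOn_stress (uniqueDiffOn_Icc hab)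
  smooth_flux := hD.jointlySmoothOn_flux (uniqueDiffOn_Icc hab)
  smooth_dissipation := hD.jointlySmoothOn_dissipation (uniqueDiffOn_Icc hab)
  energy_nonneg _ _ := curvatureNormSq_nonneg _ _
  stress_symm _ _ := stress_symm _ _
  trace_stress _ _ := sum_stress_self _ _
  stress_le _ _ := stress_quadratic_le _ _
  nonneg _ _ := dissipation_flux_stress_nonneg _ _
  divergence_stress _ ht := hD.divergence_stress ht
  hasDerivAt_energy _ ht := hD.hasDerivAt_curvatureNormSq (by rwa [interior_Icc])

/-- Each pair of times is treated on its own closed interval. The flow equation is then needed only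
in the interior, and one-sided smoothness suffices at an initial time belonging to `J`. -/
lemma IsYangMillsFlow.antitoneOn_of_weight (hD : IsYangMillsFlow J D) (hJ : J.OrdConnected)
    {Φ : ℝ → ENNReal} {H : ℝ → Rn n → ℝ} {c : ℝ → ℝ} {x₁ : Rn n} {q : Fin n → ℝ}
    (hH : ∀ a ∈ J, ∀ b ∈ J, IsBackwardWeight a b H c x₁ q)
    (hΦ : ∀ t ∈ J, Φ t = ∫⁻ x, ENNReal.ofReal (curvatureNormSq (D t) x * H t x))
    (hfin : LocallyFiniteIntegralOn Φ J) : AntitoneOn Φ J := by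
  intro a ha b hb hab
  obtain rfl | hlt := hab.eq_or_lt
  · exact le_rfl
  have hsub := hJ.out ha hb
  rw [hΦ a ha, hΦ b hb]
  refine ((hD.mono hsub).isStressFlow hlt).lintegral_weightedEnergy_le (hH a ha b hb) hlt ?_
  rw [← setLIntegral_congr_fun measurableSet_Icc fun t ht => hΦ t (hsub ht)]
  exact hfin a ha b hb

lemma ordConnected_timeInterval (α β : EReal) : (timeInterval α β).OrdConnected where
  out' _ hs _ ht _ hr := ⟨hs.1.trans (EReal.coe_le_coe_iff.2 hr.1),
    (EReal.coe_le_coe_iff.2 hr.2).trans_lt ht.2⟩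

lemma ofReal_mul_lintegral_ofReal_mul {f g : Rn n → ℝ} {r : ℝ} (hr : 0 ≤ r) :
    ENNReal.ofReal r * ∫⁻ x, ENNReal.ofReal (f x * g x) =
      ∫⁻ x, ENNReal.ofReal (f x * (r * g x)) := by
  rw [← lintegral_const_mul' _ _ ENNReal.ofReal_ne_top]
  refine lintegral_congr fun x => ?_
  rw [← ENNReal.ofReal_mul hr, mul_left_comm]

end Monotone

end YangMills

end

theorem mainTheorem8 {n : ℕ} {F : Type*} [NormedAddCommGroup F] [NormedSpace ℝ F]
    [FiniteDimensional ℝ F]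
    {V : YangMills.Rn n → Type*} [TopologicalSpace (TotalSpace F V)]
    [∀ x, NormedAddCommGroup (V x)] [∀ x, InnerProductSpace ℝ (V x)]
    [FiberBundle F V] [VectorBundle ℝ F V]
    [ContMDiffVectorBundle ∞ F V 𝓘(ℝ, YangMills.Rn n)]
    [IsContMDiffRiemannianBundle 𝓘(ℝ, YangMills.Rn n) ∞ F V]
    (α β : EReal) (hαβ : α < β)
    (D : ℝ → CovariantDerivative 𝓘(ℝ, YangMills.Rn n) F V)
    (hD : YangMills.IsYangMillsFlow (YangMills.timeInterval α β) D)
    (x₀ : YangMills.Rn n) (t₀ : ℝ) :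
    (YangMills.LocallyFiniteIntegralOn
        (fun t => YangMills.shrinkerFunctional x₀ t₀ (D t) t)
        (YangMills.timeInterval α β ∩ Iio t₀) →
      AntitoneOn (fun t => YangMills.shrinkerFunctional x₀ t₀ (D t) t)
        (YangMills.timeInterval α β ∩ Iio t₀)) ∧
    (YangMills.LocallyFiniteIntegralOn
        (fun t => YangMills.translatorFunctional x₀ t₀ (D t) t)
        (YangMills.timeInterval α β) →
      AntitoneOn (fun t => YangMills.translatorFunctional x₀ t₀ (D t) t)
        (YangMills.timeInterval α β)) ∧
    (YangMills.LocallyFiniteIntegralOn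
        (fun t => YangMills.expanderFunctional x₀ t₀ (D t) t)
        (YangMills.timeInterval α β ∩ Ioi t₀) →
      AntitoneOn (fun t => YangMills.expanderFunctional x₀ t₀ (D t) t)
        (YangMills.timeInterval α β ∩ Ioi t₀)) := by
  have hI := YangMills.ordConnected_timeInterval α β
  refine ⟨?_, ?_, ?_⟩
  -- Shrinkers and expanders share one weight formula; for `t < t₀` the coefficient `c` is negative,
  -- the Gaussian decays, and `σ = -1` makes the base of the power positive.
  · refine (hD.mono inter_subset_left).antitoneOn_of_weight (hI.inter ordConnected_Iio)
      (fun a _ b hb => YangMills.isBackwardWeight_gaussian x₀ t₀ (σ := -1) fun t ht => ?_)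
      fun t _ => ?_
    · have := ht.2.trans_lt (mem_Iio.1 hb.2)
      linarith
    · rw [YangMills.shrinkerFunctional,
        YangMills.ofReal_mul_lintegral_ofReal_mul (sq_nonneg (t - t₀))]
      simp only [YangMills.shrinkerKernel, YangMills.quadraticExponent_half_inv]
      refine lintegral_congr fun x => ?_
      rw [neg_one_mul, neg_sub, mul_div_assoc', div_mul_eq_mul_div, ← neg_sub t t₀, mul_neg,
        neg_div_neg_eq]
  · refine hD.antitoneOn_of_weight hI
      (fun a _ b _ => YangMills.isBackwardWeight_translator x₀ t₀) fun t _ => ?_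
    simp only [YangMills.translatorFunctional, YangMills.translatorKernel,
      YangMills.quadraticExponent_zero_left, ← Real.exp_add, neg_add_eq_sub]
  · refine (hD.mono inter_subset_left).antitoneOn_of_weight (hI.inter ordConnected_Ioi)
      (fun a ha b _ => YangMills.isBackwardWeight_gaussian x₀ t₀ (σ := 1) fun t ht => ?_)
      fun t _ => ?_
    · have := (mem_Ioi.1 ha.2).trans_le ht.1
      linarith
    · rw [YangMills.expanderFunctional,
        YangMills.ofReal_mul_lintegral_ofReal_mul (sq_nonneg (t₀ - t))]
      simp only [YangMills.expanderKernel, YangMills.quadraticExponent_half_inv]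
      refine lintegral_congr fun x => ?_
      rw [one_mul, mul_div_assoc', div_mul_eq_mul_div, ← neg_sub t t₀, neg_sq]
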